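/- Let $n\ge 1$ and let $\mathbb{H}^n$ be the $n$-th Heisenberg group, identified with $\mathbb{R}^{2n+1}$ through exponential coordinates, with horizontal vector fields $X_j=\partial_{x_j}-\frac{x_{n+j}}{2}\partial_{x_{2n+1}}$, $X_{n+j}=\partial_{x_{n+j}}+\frac{x_j}{2}\partial_{x_{2n+1}}$, $j=1,\dots,n$, and the inner product on $H_x\mathbb{H}^n=\mathrm{span}\{X_1(x),\dots,X_{2n}(x)\}$, with norm $|\cdot|_H$, for which $X_1,\dots,X_{2n}$ are orthonormal. A curve $\sigma\in AC([0,1],\mathbb{R}^{2n+1})$ is horizontal if $\dot\sigma(t)\in H_{\sigma(t)}\mathbb{H}^n$ for a.e. $t$; its length is $\ell_{SR}(\sigma)=\int_0^1|\dot\sigma(t)|_H\,dt$. Let $d_{SR}(x,y)$ be the infimum of $\ell_{SR}(\sigma)$ over horizontal curves with $\sigma(0)=x$, $\sigma(1)=y$. A horizontal curve is minimizing if $\ell_{SR}(\sigma)=d_{SR}(\sigma(0),\sigma(1))$. For $\sigma\in C([0,1],\mathbb{R}^{2n+1})$ let $\ell(\sigma)\in[0,\infty]$ be the supremum of $\sum_{i=1}^k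 d_{SR}(\sigma(t_{i-1}),\sigma(t_i))$ over all partitions $0=t_0<\dots<t_k=1$. Let $\mu,\nu$ be Borel probability measures with compact support on $\mathbb{H}^n$, let $\Pi(\mu,\nu)$ be the set of their transport plans (Borel probability measures on $\mathbb{H}^n\times\mathbb{H}^n$ with marginals $\mu$ and $\nu$), and let $\Pi_1(\mu,\nu)$ be the set of minimizers of $\gamma\mapsto\int d_{SR}\,d\gamma$ on $\Pi(\mu,\nu)$. Equip $C([0,1],\mathbb{R}^{2n+1})$ with the topology of uniform convergence and put $e_t(\sigma)=\sigma(t)$. Consider the problem $$(\mathrm{D})\qquad \inf\Big\{\int\ell(\sigma)\,dQ(\sigma):\ Q\in\mathcal{P}(C([0,1],\mathbb{R}^{2n+1})),\ (e_0)_\#Q=\mu,\ (e_1)_\#Q=\nu\Big\}.$$ Then: 1. (D) has a minimizer; there is even a minimizer concentrated on minimizing horizontal curves. 2. $\Pi_1(\mu,\nu)\neq\emptyset$, and the value of (D) equals $\min_{\gamma\in\Pi(\mu,\nu)}\int d_{SR}(x,y)\,d\gamma(x,y)<+\infty$. 3. A Borel probability measure $Q$ on $C([0,1],\mathbb{R}^{2n+1})$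 is a minimizer of (D) if and only if $(e_0,e_1)_\#Q\in\Pi_1(\mu,\nu)$ and $Q$ is concentrated on minimizing horizontal curves up to reparametrization, that is, for $Q$-a.e. $\sigma$ there are a minimizing horizontal curve $\eta$ and a continuous nondecreasing surjection $\varphi:[0,1]\to[0,1]$ with $\sigma=\eta\circ\varphi$. 4. If $Q$ is concentrated on absolutely continuous curves, then $Q$ is a minimizer of (D) if and only if $(e_0,e_1)_\#Q\in\Pi_1(\mu,\nu)$ and $Q$ is concentrated on minimizing horizontal curves. -/

import Mathlib

open MeasureTheory Set
open scoped ENNReal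

noncomputable section

namespace Heisenberg

/-- The underlying space of the `n`-th Heisenberg group in exponential coordinates.  A point of
`ℝ^(2n+1) = ℝ^(2n) × ℝ` is a pair `p`: the coordinate `x_j` is `p.1 (Sum.inl j)`, the coordinate
`x_(n+j)` is `p.1 (Sum.inr j)`, and the central coordinate `x_(2n+1)` is `p.2`.
Its topology and its Borel sets are the Euclidean ones. -/
abbrev Heis (n : ℕ) : Type := EuclideanSpace ℝ (Fin n ⊕ Fin n) × ℝ

/-- The left-invariant horizontal vector fields:
`X_j = ∂_j - (x_(n+j) / 2) ∂_(2n+1)` (index `Sum.inl j`) and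
`X_(n+j) = ∂_(n+j) + (x_j / 2) ∂_(2n+1)` (index `Sum.inr j`). -/
def X {n : ℕ} (i : Fin n ⊕ Fin n) (p : Heis n) : Heis n :=
  (EuclideanSpace.single i 1,
    Sum.elim (fun j => -(p.1 (Sum.inr j)) / 2) (fun j => p.1 (Sum.inl j) / 2) i)

/-- The fibre at `p` of the horizontal bundle. -/
def horizontalSpace {n : ℕ} (p : Heis n) : Submodule ℝ (Heis n) :=
  Submodule.span ℝ (Set.range fun i => X i p)

/-- The norm `|v|_H` of a horizontal vector `v`, for which the fields `X_i` are orthonormal.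
The coefficient of `X_i` in a horizontal vector is its `i`-th coordinate, so this is the Euclidean
norm of the first `2n` coordinates; see `horizontalNorm_sum`. -/
def horizontalNorm {n : ℕ} (v : Heis n) : ℝ := ‖v.1‖

theorem horizontalNorm_sum {n : ℕ} (p : Heis n) (a : Fin n ⊕ Fin n → ℝ) :
    horizontalNorm (∑ i, a i • X i p) = Real.sqrt (∑ i, a i ^ 2) := by
  have h : (∑ i, a i • X i p).1 = WithLp.toLp 2 a := by
    ext k
    rw [Prod.fst_sum]
    simp only [X, Prod.smul_fst, WithLp.ofLp_sum, Finset.sum_apply, PiLp.smul_apply,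
      PiLp.single_apply, smul_eq_mul, mul_ite, mul_one, mul_zero]
    rw [Finset.sum_ite_eq Finset.univ k a, if_pos (Finset.mem_univ k)]
  rw [horizontalNorm, h, EuclideanSpace.norm_eq]
  simp only [Real.norm_eq_abs, sq_abs]

/-- `C([0,1], ℝ^(2n+1))` with the topology of uniform convergence. -/
abbrev PathSpace (n : ℕ) : Type := C(unitInterval, Heis n)

instance (n : ℕ) : MeasurableSpace (PathSpace n) := borel _

instance (n : ℕ) : BorelSpace (PathSpace n) := ⟨rfl⟩

/-- The curve as a function on `ℝ`, constant to the left of `0` and to the right of `1`. -/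
def extend {n : ℕ} (σ : PathSpace n) : ℝ → Heis n := Set.IccExtend zero_le_one σ

/-- `σ ∈ AC([0,1], ℝ^(2n+1))`. -/
def IsAC {n : ℕ} (σ : PathSpace n) : Prop := AbsolutelyContinuousOnInterval (extend σ) 0 1

/-- Horizontal curves: absolutely continuous, with velocity in the horizontal fibre almost
everywhere. -/
def IsHorizontal {n : ℕ} (σ : PathSpace n) : Prop :=
  IsAC σ ∧ ∀ᵐ t ∂(volume.restrict (Set.Icc (0 : ℝ) 1)),
    deriv (extend σ) t ∈ horizontalSpace (extend σ t)

/-- The sub-Riemannian length `∫₀¹ |σ'(t)|_H dt` of a horizontal curve. -/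
def lengthSR {n : ℕ} (σ : PathSpace n) : ℝ≥0∞ :=
  ∫⁻ t in Set.Icc (0 : ℝ) 1, ENNReal.ofReal (horizontalNorm (deriv (extend σ) t))

/-- The sub-Riemannian (Carnot-Carathéodory) distance. -/
def dSR {n : ℕ} (x y : Heis n) : ℝ≥0∞ :=
  ⨅ (σ : PathSpace n) (_ : IsHorizontal σ ∧ σ 0 = x ∧ σ 1 = y), lengthSR σ

/-- The length of a continuous curve induced by the sub-Riemannian distance. -/
def length {n : ℕ} (σ : PathSpace n) : ℝ≥0∞ :=
  ⨆ (k : ℕ) (t : Fin (k + 1) → unitInterval) (_ : StrictMono t ∧ t 0 = 0 ∧ t (Fin.last k) = 1),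
    ∑ i : Fin k, dSR (σ (t i.castSucc)) (σ (t i.succ))

/-- Minimizing horizontal curves. -/
def IsMinimizingHorizontal {n : ℕ} (σ : PathSpace n) : Prop :=
  IsHorizontal σ ∧ lengthSR σ = dSR (σ 0) (σ 1)

/-- Minimizing horizontal curves up to reparametrization: `σ = η ∘ φ` with `η` a minimizing
horizontal curve and `φ` a continuous nondecreasing map of `[0,1]` onto itself. -/
def IsReparamOfMinimizingHorizontal {n : ℕ} (σ : PathSpace n) : Prop :=
  ∃ (η : PathSpace n) (φ : C(unitInterval, unitInterval)), IsMinimizingHorizontal η ∧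
    Monotone φ ∧ φ 0 = 0 ∧ φ 1 = 1 ∧ σ = η.comp φ

/-- The class `P_c` of compactly supported Borel probability measures. -/
structure IsCompactlySupportedProb {n : ℕ} (μ : Measure (Heis n)) : Prop where
  prob : IsProbabilityMeasure μ
  compact_support : IsCompact μ.support

/-- The transport plans between `μ` and `ν`. -/
structure IsPlan {n : ℕ} (μ ν : Measure (Heis n)) (γ : Measure (Heis n × Heis n)) : Prop where
  prob : IsProbabilityMeasure γ
  map_fst : γ.map Prod.fst = μ
  map_snd : γ.map Prod.snd = ν

/-- The transport cost of a plan. -/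
def planCost {n : ℕ} (γ : Measure (Heis n × Heis n)) : ℝ≥0∞ := ∫⁻ p, dSR p.1 p.2 ∂γ

/-- The value of the Monge-Kantorovich problem. -/
def mongeKantorovich {n : ℕ} (μ ν : Measure (Heis n)) : ℝ≥0∞ :=
  ⨅ (γ : Measure (Heis n × Heis n)) (_ : IsPlan μ ν γ), planCost γ

/-- The optimal transport plans. -/
def IsOptimalPlan {n : ℕ} (μ ν : Measure (Heis n)) (γ : Measure (Heis n × Heis n)) : Prop :=
  IsPlan μ ν γ ∧ ∀ γ', IsPlan μ ν γ' → planCost γ ≤ planCost γ'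

/-- The admissible measures of the Lagrangian problem: Borel probability measures on the path space
with `(e_0)_# Q = μ` and `(e_1)_# Q = ν`. -/
structure IsAdmissible {n : ℕ} (μ ν : Measure (Heis n)) (Q : Measure (PathSpace n)) : Prop where
  prob : IsProbabilityMeasure Q
  map_zero : Q.map (fun σ => σ 0) = μ
  map_one : Q.map (fun σ => σ 1) = ν

/-- The functional `∫ ℓ(σ) dQ(σ)`. -/
def lagrangianCost {n : ℕ} (Q : Measure (PathSpace n)) : ℝ≥0∞ := ∫⁻ σ, length σ ∂Q

/-- The value of the Lagrangian problem. -/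
def lagrangianValue {n : ℕ} (μ ν : Measure (Heis n)) : ℝ≥0∞ :=
  ⨅ (Q : Measure (PathSpace n)) (_ : IsAdmissible μ ν Q), lagrangianCost Q

/-- The solutions of the Lagrangian problem. -/
def IsLagrangianOptimal {n : ℕ} (μ ν : Measure (Heis n)) (Q : Measure (PathSpace n)) : Prop :=
  IsAdmissible μ ν Q ∧ ∀ Q', IsAdmissible μ ν Q' → lagrangianCost Q ≤ lagrangianCost Q'

/-- The joint law `(e_0, e_1)_# Q` of the endpoints. -/
def endpointLaw {n : ℕ} (Q : Measure (PathSpace n)) : Measure (Heis n × Heis n) :=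
  Q.map (fun σ => (σ 0, σ 1))

end Heisenberg

end

/-! A continuous curve satisfies `dSR (σ 0) (σ 1) ≤ length σ`, so the Lagrangian cost of `Q` is at
least the transport cost of its endpoint law. Everything rests on two facts: which curves give
equality, and that every transport plan is the endpoint law of a measure on such curves.

Equality case (`length_eq_dSR_iff`). If the length equals the distance of the end points, the
triangle inequality makes `t ↦ dSR (σ 0) (σ t)` a continuous nondecreasing control of the increments
of `σ`. Using it as a parameter gives a curve of constant speed, Lipschitz for the Euclidean
distance. At a point of differentiability the estimate `|vert x y| ≤ dSR x y ^ 2` forces the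
velocity to be horizontal, and its norm is at most the derivative of the control
(`IsAC.isHorizontal_of_dSR_le`). For an absolutely continuous `σ` this argument applies to `σ`
itself, without reparametrization.

Lifting of plans (`IsPlan.exists_lift`). Constant-speed geodesics with end points in a compact set
form a compact set, and the endpoint map sends it onto all pairs of points. No measurable selection
of geodesics is made: integration against the plan is a positive functional on the functions of the
end points, which is extended by the Riesz extension theorem and represented by a measure.

Optimal plans are then found by minimizing a continuous function on a compact set of probability
measures on geodesics. At a minimum the Lagrangian and transport costs agree and are finite, so a
solution must have `length σ = dSR (σ 0) (σ 1)` almost everywhere. -/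

noncomputable section

/-! ### Absolutely continuous curves -/

namespace AbsolutelyContinuousOnInterval

variable {X Y : Type*} [PseudoMetricSpace X] [PseudoMetricSpace Y]

/-- Monotonicity keeps the images of disjoint intervals disjoint, and the Lipschitz bound controls
their total length. -/
theorem comp_monotone {f : ℝ → X} {φ : ℝ → ℝ} {a b c d : ℝ} {K : NNReal}
    (hf : AbsolutelyContinuousOnInterval f a b) (hφ : Monotone φ) (hK : LipschitzWith K φ)
    (hmap : ∀ x ∈ uIcc c d, φ x ∈ uIcc a b) :
    AbsolutelyContinuousOnInterval (fun t => f (φ t)) c d := by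
  rw [absolutelyContinuousOnInterval_iff] at hf ⊢
  intro ε hε
  obtain ⟨δ, hδ, h⟩ := hf ε hε
  -- `K + 1` rather than `K`, since `K` may vanish.
  refine ⟨δ / (K + 1), by positivity, fun E hE hsum => ?_⟩
  refine h (E.1, fun i => (φ (E.2 i).1, φ (E.2 i).2)) ⟨fun i hi => ?_, ?_⟩ ?_
  · exact ⟨hmap _ (hE.1 i hi).1, hmap _ (hE.1 i hi).2⟩
  · intro i hi j hj hij
    have hd := Set.disjoint_left.1 (hE.2 hi hj hij)
    refine Set.disjoint_left.2 fun z hz hz' => ?_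
    simp only [mem_uIoc] at hd hz hz'
    -- If `z` lies in both image intervals, comparing values of `φ` shows that `min q q'` lies in
    -- both original intervals.
    have key : ∀ p q p' q' : ℝ, (∀ y, p < y → y ≤ q → ¬ (p' < y ∧ y ≤ q')) →
        φ p < z → z ≤ φ q → φ p' < z → z ≤ φ q' → False := by
      intro p q p' q' hy h1 h2 h3 h4
      have e1 : p < q := lt_of_not_ge fun hh => (h1.trans_le h2).not_ge (hφ hh)
      have e2 : p' < q' := lt_of_not_ge fun hh => (h3.trans_le h4).not_ge (hφ hh)
      have e3 : p < q' := lt_of_not_ge fun hh => (h1.trans_le h4).not_ge (hφ hh)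
      have e4 : p' < q := lt_of_not_ge fun hh => (h3.trans_le h2).not_ge (hφ hh)
      exact hy (min q q') (lt_min e1 e3) (min_le_left _ _)
        ⟨lt_min e4 e2, min_le_right _ _⟩
    rcases hz with hz | hz <;> rcases hz' with hz' | hz'
    · exact key _ _ _ _ (fun y h1 h2 h3 => hd (Or.inl ⟨h1, h2⟩) (Or.inl h3)) hz.1 hz.2 hz'.1 hz'.2
    · exact key _ _ _ _ (fun y h1 h2 h3 => hd (Or.inl ⟨h1, h2⟩) (Or.inr h3)) hz.1 hz.2 hz'.1 hz'.2
    · exact key _ _ _ _ (fun y h1 h2 h3 => hd (Or.inr ⟨h1, h2⟩) (Or.inl h3)) hz.1 hz.2 hz'.1 hz'.2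
    · exact key _ _ _ _ (fun y h1 h2 h3 => hd (Or.inr ⟨h1, h2⟩) (Or.inr h3)) hz.1 hz.2 hz'.1 hz'.2
  · calc ∑ i ∈ Finset.range E.1, dist (φ (E.2 i).1) (φ (E.2 i).2)
        ≤ ∑ i ∈ Finset.range E.1, K * dist (E.2 i).1 (E.2 i).2 :=
          Finset.sum_le_sum fun i _ => hK.dist_le_mul _ _
      _ = K * ∑ i ∈ Finset.range E.1, dist (E.2 i).1 (E.2 i).2 := (Finset.mul_sum ..).symm
      _ ≤ K * (δ / (K + 1)) := by gcongr
      _ < (K + 1) * (δ / (K + 1)) := by gcongr; linarith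
      _ = δ := by field

theorem lipschitz_comp {f : ℝ → X} {g : X → Y} {a b : ℝ} {K : NNReal}
    (hf : AbsolutelyContinuousOnInterval f a b) (hg : LipschitzWith K g) :
    AbsolutelyContinuousOnInterval (fun t => g (f t)) a b := by
  refine squeeze_zero (fun E => Finset.sum_nonneg fun i _ => dist_nonneg) (fun E => ?_)
    (by simpa using Filter.Tendsto.const_mul (K : ℝ) hf)
  rw [Finset.mul_sum]
  exact Finset.sum_le_sum fun i _ => hg.dist_le_mul _ _

/-- Increments of a linear functional along an absolutely continuous curve are controlled by the
integral of any bound for its derivative. -/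
theorem ofReal_abs_sub_le_lintegral {E : Type*} [NormedAddCommGroup E] [NormedSpace ℝ E]
    [FiniteDimensional ℝ E] {f : ℝ → E} {a b : ℝ} (hab : a ≤ b)
    (hf : AbsolutelyContinuousOnInterval f a b) (A : E →L[ℝ] ℝ) {g : ℝ → ℝ}
    (hg : ∀ᵐ t ∂volume.restrict (Icc a b), |A (deriv f t)| ≤ g t) :
    ENNReal.ofReal |A (f b) - A (f a)| ≤ ∫⁻ t in Icc a b, ENNReal.ofReal (g t) := by
  have hA : AbsolutelyContinuousOnInterval (fun t => A (f t)) a b := hf.lipschitz_comp A.lipschitz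
  have hd : ∀ᵐ t ∂volume.restrict (Icc a b), deriv (fun t => A (f t)) t = A (deriv f t) := by
    rw [ae_restrict_iff' measurableSet_Icc]
    filter_upwards [hf.boundedVariationOn.ae_differentiableAt_of_mem_uIcc] with t ht hmem
    rw [uIcc_of_le hab] at ht
    exact (A.hasFDerivAt.comp_hasDerivAt t (ht hmem).hasDerivAt).deriv
  have hint := hA.integral_deriv_eq_sub
  rw [intervalIntegral.integral_of_le hab, ← integral_Icc_eq_integral_Ioc] at hint
  rw [← hint, ← Real.norm_eq_abs, ofReal_norm]
  refine (enorm_integral_le_lintegral_enorm _).trans (lintegral_mono_ae ?_)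
  filter_upwards [hd, hg] with t h1 h2
  rw [h1, ← ofReal_norm, Real.norm_eq_abs]
  exact ENNReal.ofReal_le_ofReal h2

end AbsolutelyContinuousOnInterval

/-! ### The horizontal distribution as the kernel of a contact form -/

namespace Heisenberg

variable {n : ℕ}

/-- The complex structure of the horizontal plane. -/
def J : EuclideanSpace ℝ (Fin n ⊕ Fin n) →ₗ[ℝ] EuclideanSpace ℝ (Fin n ⊕ Fin n) where
  toFun z := WithLp.toLp 2 (Sum.elim (fun j => -z (Sum.inr j)) fun j => z (Sum.inl j))
  map_add' z w := by
    ext (i | i) <;> simp; ring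
  map_smul' c z := by
    ext (i | i) <;> simp

@[simp] theorem J_inl (z : EuclideanSpace ℝ (Fin n ⊕ Fin n)) (j : Fin n) :
    J z (Sum.inl j) = -z (Sum.inr j) := rfl

@[simp] theorem J_inr (z : EuclideanSpace ℝ (Fin n ⊕ Fin n)) (j : Fin n) :
    J z (Sum.inr j) = z (Sum.inl j) := rfl

theorem norm_J (z : EuclideanSpace ℝ (Fin n ⊕ Fin n)) : ‖J z‖ = ‖z‖ := by
  simp only [EuclideanSpace.norm_eq, Fintype.sum_sum_type, J_inl, J_inr, norm_neg]
  rw [add_comm]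

theorem inner_J_self (z : EuclideanSpace ℝ (Fin n ⊕ Fin n)) : inner ℝ (J z) z = 0 := by
  simp only [PiLp.inner_apply, Fintype.sum_sum_type, J_inl, J_inr, ← Finset.sum_add_distrib]
  exact Finset.sum_eq_zero fun i _ => by simp; ring

theorem abs_inner_J_le (z w : EuclideanSpace ℝ (Fin n ⊕ Fin n)) :
    |inner ℝ (J z) w| ≤ ‖z‖ * ‖w‖ := by
  rw [← norm_J z]; exact abs_real_inner_le_norm _ _

theorem X_snd (i : Fin n ⊕ Fin n) (p : Heis n) : (X i p).2 = 1 / 2 * J p.1 i := by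
  rcases i with i | i <;> simp [X] <;> ring

theorem mem_horizontalSpace_iff {p v : Heis n} :
    v ∈ horizontalSpace p ↔ v.2 = 1 / 2 * inner ℝ (J p.1) v.1 := by
  constructor
  · intro h
    induction h using Submodule.span_induction with
    | mem x hx =>
      obtain ⟨i, rfl⟩ := hx
      simp only [X_snd]
      simp [X, EuclideanSpace.inner_single_right]
    | zero => simp
    | add x y _ _ hx hy => simp only [Prod.snd_add, Prod.fst_add, inner_add_right, hx, hy]; ring
    | smul a x _ hx => simp only [Prod.smul_snd, Prod.smul_fst, inner_smul_right, hx, smul_eq_mul]; ring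
  · intro h
    have hv : v = ∑ i, v.1 i • X i p := by
      refine Prod.ext ?_ ?_
      · ext k
        simp only [X, Prod.fst_sum, Prod.smul_fst, WithLp.ofLp_sum, Finset.sum_apply,
          PiLp.smul_apply, PiLp.single_apply, smul_eq_mul, mul_ite, mul_one, mul_zero]
        rw [Finset.sum_ite_eq Finset.univ k, if_pos (Finset.mem_univ k)]
      · rw [h, Prod.snd_sum, PiLp.inner_apply, Finset.mul_sum]
        refine Finset.sum_congr rfl fun i _ => ?_
        rw [Prod.smul_snd, X_snd, smul_eq_mul]
        simp; ring
    rw [hv]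
    exact Submodule.sum_mem _ fun i _ => Submodule.smul_mem _ _ (Submodule.subset_span ⟨i, rfl⟩)

/-! ### Curves on arbitrary intervals and the triangle inequality -/

theorem extend_coe (σ : PathSpace n) (t : unitInterval) : extend σ t = σ t :=
  Set.IccExtend_val _ _ t

theorem extend_zero (σ : PathSpace n) : extend σ 0 = σ 0 := extend_coe σ 0

theorem extend_one (σ : PathSpace n) : extend σ 1 = σ 1 := extend_coe σ 1

theorem extend_of_le_zero (σ : PathSpace n) {t : ℝ} (ht : t ≤ 0) : extend σ t = σ 0 :=
  Set.IccExtend_of_le_left _ _ ht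

theorem extend_of_one_le (σ : PathSpace n) {t : ℝ} (ht : 1 ≤ t) : extend σ t = σ 1 :=
  Set.IccExtend_of_right_le _ _ ht

/-- The path that follows `f` on `[0,1]`. -/
def pathOf (f : ℝ → Heis n) (hf : ContinuousOn f (Icc 0 1)) : PathSpace n :=
  ⟨fun t => f t, by
    exact hf.comp_continuous continuous_subtype_val fun t => t.2⟩

theorem extend_pathOf (f : ℝ → Heis n) (hf : ContinuousOn f (Icc 0 1)) {t : ℝ}
    (ht : t ∈ Icc (0 : ℝ) 1) : extend (pathOf f hf) t = f t :=
  Set.IccExtend_of_mem _ _ ht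

theorem ae_Icc_iff_Ioo {a b : ℝ} {p : ℝ → Prop} :
    (∀ᵐ t ∂volume.restrict (Icc a b), p t) ↔ ∀ᵐ t ∂volume.restrict (Ioo a b), p t := by
  rw [restrict_Ioo_eq_restrict_Icc]

theorem deriv_extend_pathOf (f : ℝ → Heis n) (hf : ContinuousOn f (Icc 0 1)) {t : ℝ}
    (ht : t ∈ Ioo (0 : ℝ) 1) : deriv (extend (pathOf f hf)) t = deriv f t :=
  Filter.EventuallyEq.deriv_eq <| by
    filter_upwards [Icc_mem_nhds ht.1 ht.2] with s hs using extend_pathOf f hf hs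

theorem _root_.AbsolutelyContinuousOnInterval.congr_Icc {Y : Type*} [PseudoMetricSpace Y]
    {f g : ℝ → Y} {a b : ℝ} (hf : AbsolutelyContinuousOnInterval f a b)
    (h : ∀ t ∈ uIcc a b, g t = f t) : AbsolutelyContinuousOnInterval g a b := by
  rw [absolutelyContinuousOnInterval_iff] at hf ⊢
  intro ε hε
  obtain ⟨δ, hδ, H⟩ := hf ε hε
  refine ⟨δ, hδ, fun E hE hs => ?_⟩
  rw [Finset.sum_congr rfl fun i hi => by rw [h _ (hE.1 i hi).1, h _ (hE.1 i hi).2]]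
  exact H E hE hs

/-- A curve that is absolutely continuous and horizontal on `[0,1]` bounds the distance. -/
theorem dSR_le_of_unit {f : ℝ → Heis n} (hf : AbsolutelyContinuousOnInterval f 0 1)
    (hh : ∀ᵐ t ∂volume.restrict (Icc (0 : ℝ) 1), deriv f t ∈ horizontalSpace (f t)) :
    dSR (f 0) (f 1) ≤ ∫⁻ t in Icc (0 : ℝ) 1, ENNReal.ofReal ‖(deriv f t).1‖ := by
  have hc : ContinuousOn f (Icc 0 1) := by simpa [uIcc_of_le] using hf.continuousOn
  have hlen : lengthSR (pathOf f hc) = ∫⁻ t in Icc (0 : ℝ) 1, ENNReal.ofReal ‖(deriv f t).1‖ := by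
    rw [lengthSR, ← restrict_Ioo_eq_restrict_Icc]
    exact setLIntegral_congr_fun measurableSet_Ioo fun t ht => by
      simp only [horizontalNorm, deriv_extend_pathOf f hc ht]
  rw [← hlen]
  refine iInf₂_le (pathOf f hc) ⟨⟨?_, ?_⟩, by simp [pathOf], by simp [pathOf]⟩
  · refine hf.congr_Icc fun t ht => ?_
    exact extend_pathOf f hc (by simpa [uIcc_of_le] using ht)
  · rw [ae_Icc_iff_Ioo] at hh ⊢
    filter_upwards [hh, ae_restrict_mem measurableSet_Ioo] with t h1 h2
    rw [deriv_extend_pathOf f hc h2, extend_pathOf f hc (Ioo_subset_Icc_self h2)]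
    exact h1

/-- A curve that is absolutely continuous and horizontal on `[a,b]` bounds the distance. -/
theorem dSR_le_lintegral {f : ℝ → Heis n} {a b : ℝ} (hab : a < b)
    (hf : AbsolutelyContinuousOnInterval f a b)
    (hh : ∀ᵐ t ∂volume.restrict (Icc a b), deriv f t ∈ horizontalSpace (f t)) :
    dSR (f a) (f b) ≤ ∫⁻ t in Icc a b, ENNReal.ofReal ‖(deriv f t).1‖ := by
  have hba : 0 < b - a := sub_pos.2 hab
  set φ : ℝ → ℝ := fun t => (b - a) * t + a with hφ
  have hmono : Monotone φ := fun s t h => by simp only [hφ]; gcongr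
  have hlip : LipschitzWith (b - a).toNNReal φ := LipschitzWith.of_dist_le_mul fun s t => by
    simp only [hφ, Real.dist_eq, Real.coe_toNNReal _ hba.le]
    rw [add_sub_add_right_eq_sub, ← mul_sub, abs_mul, abs_of_pos hba]
  have hg : AbsolutelyContinuousOnInterval (fun t => f (φ t)) 0 1 := by
    refine hf.comp_monotone hmono hlip fun t ht => ?_
    rw [uIcc_of_le zero_le_one] at ht
    rw [uIcc_of_le hab.le]
    constructor <;> simp only [hφ] <;> nlinarith [ht.1, ht.2]
  have hderiv : ∀ t, deriv (fun t => f (φ t)) t = (b - a) • deriv f (φ t) := fun t => by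
    have h1 := deriv_comp_mul_left (b - a) (fun s => f (s + a)) t
    rw [deriv_comp_add_const] at h1
    exact h1
  have hemb : MeasurableEmbedding φ :=
    ((Homeomorph.mulLeft₀ (b - a) hba.ne').trans (Homeomorph.addRight a)).measurableEmbedding
  have himg : φ ⁻¹' Icc a b = Icc 0 1 := by
    ext t
    simp only [hφ, mem_preimage, mem_Icc]
    constructor
    · rintro ⟨h1, h2⟩; constructor <;> nlinarith
    · rintro ⟨h1, h2⟩; constructor <;> nlinarith
  have hmap : (volume.restrict (Icc (0 : ℝ) 1)).map φ
      = ENNReal.ofReal (b - a)⁻¹ • volume.restrict (Icc a b) := by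
    rw [← himg, ← hemb.restrict_map, ← Measure.restrict_smul]
    congr 1
    have : φ = (fun x => x + a) ∘ fun x => (b - a) * x := rfl
    rw [this, ← Measure.map_map (by fun_prop) (by fun_prop), Real.map_volume_mul_left hba.ne',
      Measure.map_smul, map_add_right_eq_self, abs_of_pos (inv_pos.2 hba)]
  have h01 : dSR (f a) (f b)
      ≤ ∫⁻ t in Icc (0 : ℝ) 1, ENNReal.ofReal ‖(deriv (fun t => f (φ t)) t).1‖ := by
    have := dSR_le_of_unit hg ?_
    · simpa [hφ] using this
    · have h2 : ∀ᵐ t ∂(volume.restrict (Icc (0 : ℝ) 1)).map φ,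
          deriv f t ∈ horizontalSpace (f t) := by
        rw [hmap]; exact Measure.ae_smul_measure hh _
      filter_upwards [ae_of_ae_map hemb.measurable.aemeasurable h2] with t ht
      rw [hderiv]
      exact Submodule.smul_mem _ _ ht
  refine h01.trans_eq ?_
  have h3 : ∀ t, ENNReal.ofReal ‖(deriv (fun t => f (φ t)) t).1‖
      = ENNReal.ofReal (b - a) * ENNReal.ofReal ‖(deriv f (φ t)).1‖ := fun t => by
    rw [hderiv, Prod.smul_fst, norm_smul, Real.norm_eq_abs, abs_of_pos hba,
      ENNReal.ofReal_mul hba.le]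
  simp_rw [h3]
  rw [lintegral_const_mul' _ _ ENNReal.ofReal_ne_top,
    ← hemb.lintegral_map (fun t => ENNReal.ofReal ‖(deriv f t).1‖), hmap, lintegral_smul_measure,
    smul_eq_mul, ← mul_assoc, ← ENNReal.ofReal_mul hba.le, mul_inv_cancel₀ hba.ne',
    ENNReal.ofReal_one, one_mul]

theorem dSR_self (x : Heis n) : dSR x x = 0 := by
  have h := dSR_le_of_unit (f := fun _ => x)
    ((LipschitzWith.const x).lipschitzOnWith.absolutelyContinuousOnInterval) (by simp)
  simpa using h

theorem monotone_clamp : Monotone fun t : ℝ => max 0 (min 1 t) :=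
  fun _ _ h => max_le_max le_rfl (min_le_min le_rfl h)

/-- The extended curve factors through the clamp onto `[0,1]`, which is monotone and 1-Lipschitz. -/
theorem IsAC.extend_comp {σ : PathSpace n} (hσ : IsAC σ) (a b c : ℝ) :
    AbsolutelyContinuousOnInterval (fun t => extend σ (t - c)) a b := by
  have hlip : LipschitzWith 1 fun t : ℝ => max 0 (min 1 (t - c)) := by
    have : LipschitzWith 1 fun t : ℝ => t - c := LipschitzWith.of_dist_le_mul fun s t => by simp
    exact (this.const_min 1).const_max 0
  have := AbsolutelyContinuousOnInterval.comp_monotone (c := a) (d := b) hσ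
    (φ := fun t => max 0 (min 1 (t - c))) (fun s t h => monotone_clamp (sub_le_sub_right h c))
    hlip fun t _ => by
      rw [uIcc_of_le zero_le_one]; exact ⟨le_max_left _ _, by simp⟩
  refine this.congr_Icc fun t _ => ?_
  rcases le_total (t - c) 0 with h | h
  · rw [extend_of_le_zero σ h, min_eq_right (h.trans zero_le_one), max_eq_left h, extend_zero]
  rcases le_total (t - c) 1 with h' | h'
  · rw [min_eq_right h', max_eq_right h]
  · rw [extend_of_one_le σ h', min_eq_left h', max_eq_right zero_le_one, extend_one]

theorem dSR_triangle (x y z : Heis n) : dSR x z ≤ dSR x y + dSR y z := by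
  rw [dSR, dSR, dSR]
  simp only [ENNReal.iInf_add, ENNReal.add_iInf]
  refine le_iInf₂ fun τ hτ => le_iInf₂ fun σ hσ => ?_
  obtain ⟨hσ, rfl, rfl⟩ := hσ
  obtain ⟨hτ, hστ, rfl⟩ := hτ
  -- Concatenation on `[0,2]` written as a sum: each extended curve is constant while the other one
  -- moves, so absolute continuity is inherited from the summands.
  set f : ℝ → Heis n := fun t => extend σ t + (extend τ (t - 1) - σ 1) with hf
  have hAC : AbsolutelyContinuousOnInterval f 0 2 := by
    have h1 := hσ.1.extend_comp 0 2 0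
    have h2 := hτ.1.extend_comp 0 2 1
    simp only [sub_zero] at h1
    exact h1.fun_add (h2.fun_sub
      ((LipschitzWith.const (σ 1)).lipschitzOnWith.absolutelyContinuousOnInterval))
  have hf1 : ∀ t ≤ 1, f t = extend σ t := fun t ht => by
    simp only [hf]; rw [extend_of_le_zero τ (by linarith), hστ]; simp
  have hf2 : ∀ t, 1 ≤ t → f t = extend τ (t - 1) := fun t ht => by
    simp only [hf]; rw [extend_of_one_le σ ht]; simp
  have hd1 : ∀ t < 1, deriv f t = deriv (extend σ) t := fun t ht =>
    Filter.EventuallyEq.deriv_eq <| by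
      filter_upwards [Iio_mem_nhds ht] with s hs using hf1 s hs.le
  have hd2 : ∀ t, 1 < t → deriv f t = deriv (extend τ) (t - 1) := fun t ht => by
    rw [← deriv_comp_sub_const]
    exact Filter.EventuallyEq.deriv_eq <| by
      filter_upwards [Ioi_mem_nhds ht] with s hs using hf2 s (le_of_lt hs)
  have hmp : MeasurePreserving (fun t : ℝ => t - 1) (volume.restrict (Ioo 1 2))
      (volume.restrict (Ioo 0 1)) := by
    have := (measurePreserving_sub_right (volume : Measure ℝ) 1).restrict_preimage
      (measurableSet_Ioo (a := (0 : ℝ)) (b := 1))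
    simpa [Set.preimage_sub_const_Ioo, one_add_one_eq_two] using this
  have hsplit : volume.restrict (Icc (0 : ℝ) 2)
      ≤ volume.restrict (Ioo 0 1) + volume.restrict (Ioo 1 2) := by
    rw [restrict_Ioo_eq_restrict_Icc, restrict_Ioo_eq_restrict_Icc,
      ← Icc_union_Icc_eq_Icc (zero_le_one : (0 : ℝ) ≤ 1) one_le_two]
    exact Measure.restrict_union_le _ _
  have hh : ∀ᵐ t ∂volume.restrict (Icc (0 : ℝ) 2), deriv f t ∈ horizontalSpace (f t) := by
    refine ae_mono hsplit (ae_add_measure_iff.2 ⟨?_, ?_⟩)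
    · filter_upwards [ae_Icc_iff_Ioo.1 hσ.2, ae_restrict_mem measurableSet_Ioo] with t h1 h2
      rw [hd1 t h2.2, hf1 t h2.2.le]; exact h1
    · filter_upwards [hmp.quasiMeasurePreserving.ae (ae_Icc_iff_Ioo.1 hτ.2),
        ae_restrict_mem measurableSet_Ioo] with t h1 h2
      rw [hd2 t h2.1, hf2 t h2.1.le]; exact h1
  have h0 : f 0 = σ 0 := by rw [hf1 0 zero_le_one, extend_zero]
  have h2 : f 2 = τ 1 := by rw [hf2 2 one_le_two]; norm_num [extend_one]
  have := dSR_le_lintegral two_pos hAC hh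
  rw [h0, h2] at this
  rw [← dSR]
  refine this.trans <| (lintegral_mono' hsplit le_rfl).trans ?_
  rw [lintegral_add_measure]
  refine add_le_add ?_ ?_
  · rw [lengthSR, ← restrict_Ioo_eq_restrict_Icc]
    refine (setLIntegral_congr_fun measurableSet_Ioo fun t ht => ?_).le
    simp only [hd1 t ht.2, horizontalNorm]
  · rw [lengthSR, ← restrict_Ioo_eq_restrict_Icc]
    have hmeas : MeasurableEmbedding fun t : ℝ => t - 1 :=
      (Homeomorph.subRight (1 : ℝ)).measurableEmbedding
    rw [← hmp.lintegral_comp_emb hmeas]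
    refine (setLIntegral_congr_fun measurableSet_Ioo fun t ht => ?_).le
    simp only [hd2 t ht.1, horizontalNorm]

/-! ### Lower bounds for the distance -/

/-- The central coordinate of `x⁻¹ y`. -/
def vert (x y : Heis n) : ℝ := y.2 - x.2 - 1 / 2 * inner ℝ (J x.1) y.1

theorem vert_self (x : Heis n) : vert x x = 0 := by simp [vert, inner_J_self]

theorem vert_eq (x y : Heis n) : vert x y = y.2 - x.2 - 1 / 2 * inner ℝ (J x.1) (y.1 - x.1) := by
  simp [vert, inner_sub_right, inner_J_self]

theorem continuous_vert : Continuous fun p : Heis n × Heis n => vert p.1 p.2 := by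
  have : Continuous (J : EuclideanSpace ℝ (Fin n ⊕ Fin n) →ₗ[ℝ] _) :=
    LinearMap.continuous_of_finiteDimensional _
  unfold vert
  fun_prop

theorem ofReal_norm_fst_sub_le {f : ℝ → Heis n} {a b : ℝ} (hab : a ≤ b)
    (hf : AbsolutelyContinuousOnInterval f a b) :
    ENNReal.ofReal ‖(f b).1 - (f a).1‖ ≤ ∫⁻ t in Icc a b, ENNReal.ofReal ‖(deriv f t).1‖ := by
  -- Testing the velocity against the displacement `u` itself gives `‖u‖²` on the left and a factor
  -- `‖u‖` on the right.
  set u := (f b).1 - (f a).1 with hu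
  rcases eq_or_ne u 0 with h0 | h0
  · simp [h0]
  have hu0 : 0 < ‖u‖ := norm_pos_iff.2 h0
  have h := hf.ofReal_abs_sub_le_lintegral hab
    ((innerSL ℝ u).comp (ContinuousLinearMap.fst ℝ _ _)) (g := fun t => ‖u‖ * ‖(deriv f t).1‖)
    (Filter.Eventually.of_forall fun t => by
      simpa using abs_real_inner_le_norm u (deriv f t).1)
  simp only [ContinuousLinearMap.comp_apply, ContinuousLinearMap.coe_fst', innerSL_apply_apply,
    ← inner_sub_right, ← hu, real_inner_self_eq_norm_sq, sq, abs_mul, abs_norm, ENNReal.ofReal_mul hu0.le] at h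
  rw [lintegral_const_mul' _ _ ENNReal.ofReal_ne_top] at h
  exact (ENNReal.mul_le_mul_iff_right (ENNReal.ofReal_pos.2 hu0).ne'
    ENNReal.ofReal_ne_top).1 h

/-- The central increment is quadratic in the length: seen from `f a`, a horizontal velocity has
vertical part `1/2 ⟨J (z t - z a), z' t⟩`, where `z` is the projected curve, and `‖z t - z a‖` is
itself at most the length. -/
theorem ofReal_abs_vert_le {f : ℝ → Heis n} {a b : ℝ} (hab : a ≤ b)
    (hf : AbsolutelyContinuousOnInterval f a b)
    (hh : ∀ᵐ t ∂volume.restrict (Icc a b), deriv f t ∈ horizontalSpace (f t)) :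
    ENNReal.ofReal |vert (f a) (f b)| ≤ (∫⁻ t in Icc a b, ENNReal.ofReal ‖(deriv f t).1‖) ^ 2 := by
  set ℓ := ∫⁻ t in Icc a b, ENNReal.ofReal ‖(deriv f t).1‖ with hℓ
  rcases eq_or_ne ℓ ∞ with htop | htop
  · simp [htop]
  have hz : ∀ t ∈ Icc a b, ‖(f t).1 - (f a).1‖ ≤ ℓ.toReal := fun t ht => by
    rw [← ENNReal.ofReal_le_iff_le_toReal htop]
    refine (ofReal_norm_fst_sub_le ht.1 (hf.mono ?_)).trans
      (lintegral_mono_set (Icc_subset_Icc_right ht.2))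
    rw [uIcc_of_le ht.1, uIcc_of_le hab]
    exact Icc_subset_Icc_right ht.2
  have h := hf.ofReal_abs_sub_le_lintegral hab
    (ContinuousLinearMap.snd ℝ _ _ - (1 / 2 : ℝ) •
      (innerSL ℝ (J (f a).1)).comp (ContinuousLinearMap.fst ℝ _ _))
    (g := fun t => ℓ.toReal * ‖(deriv f t).1‖) (by
      filter_upwards [hh, ae_restrict_mem measurableSet_Icc] with t h1 h2
      rw [mem_horizontalSpace_iff] at h1
      simp only [sub_apply, smul_apply,
        ContinuousLinearMap.comp_apply, ContinuousLinearMap.coe_fst', innerSL_apply_apply,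
        ContinuousLinearMap.coe_snd', smul_eq_mul, h1]
      rw [← mul_sub, ← inner_sub_left, ← map_sub, abs_mul]
      calc |(1 / 2 : ℝ)| * |inner ℝ (J ((f t).1 - (f a).1)) (deriv f t).1|
          ≤ 1 * (‖(f t).1 - (f a).1‖ * ‖(deriv f t).1‖) := by
            gcongr
            · norm_num [abs_of_pos]
            · exact abs_inner_J_le _ _
        _ ≤ ℓ.toReal * ‖(deriv f t).1‖ := by
            rw [one_mul]; gcongr; exact hz t h2)
  have hv : |vert (f a) (f b)| = |(f b).2 - 1 / 2 * inner ℝ (J (f a).1) (f b).1 -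
      ((f a).2 - 1 / 2 * inner ℝ (J (f a).1) (f a).1)| := by
    rw [inner_J_self, vert]; ring_nf
  simp only [sub_apply, smul_apply,
    ContinuousLinearMap.comp_apply, ContinuousLinearMap.coe_fst', innerSL_apply_apply,
    ContinuousLinearMap.coe_snd', smul_eq_mul, ← hv] at h
  refine h.trans_eq ?_
  simp_rw [ENNReal.ofReal_mul ENNReal.toReal_nonneg]
  rw [lintegral_const_mul' _ _ ENNReal.ofReal_ne_top, ENNReal.ofReal_toReal htop, ← hℓ, sq]

theorem ofReal_norm_fst_sub_le_dSR (x y : Heis n) : ENNReal.ofReal ‖y.1 - x.1‖ ≤ dSR x y := by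
  refine le_iInf₂ fun σ hσ => ?_
  obtain ⟨hσ, rfl, rfl⟩ := hσ
  rw [← extend_zero, ← extend_one]
  exact ofReal_norm_fst_sub_le zero_le_one hσ.1

theorem ofReal_abs_vert_le_dSR_sq (x y : Heis n) : ENNReal.ofReal |vert x y| ≤ dSR x y ^ 2 := by
  -- The square root is taken first so that the bound can be checked curve by curve under the
  -- infimum.
  have key : ENNReal.ofReal |vert x y| ^ (1 / 2 : ℝ) ≤ dSR x y := by
    refine le_iInf₂ fun σ hσ => ?_
    obtain ⟨hσ, rfl, rfl⟩ := hσ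
    rw [← extend_zero, ← extend_one, ← ENNReal.le_rpow_inv_iff (by norm_num)]
    refine (ofReal_abs_vert_le zero_le_one hσ.1 hσ.2).trans_eq ?_
    rw [← ENNReal.rpow_natCast]
    norm_num [lengthSR, horizontalNorm]
  calc ENNReal.ofReal |vert x y| = (ENNReal.ofReal |vert x y| ^ (1 / 2 : ℝ)) ^ 2 := by
        rw [← ENNReal.rpow_natCast, ← ENNReal.rpow_mul]; norm_num
    _ ≤ _ := by gcongr

theorem norm_fst_sub_le_of_dSR_le {x y : Heis n} {r : ℝ} (hr : 0 ≤ r)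
    (h : dSR x y ≤ ENNReal.ofReal r) : ‖y.1 - x.1‖ ≤ r :=
  (ENNReal.ofReal_le_ofReal_iff hr).1 ((ofReal_norm_fst_sub_le_dSR x y).trans h)

theorem abs_vert_le_of_dSR_le {x y : Heis n} {r : ℝ} (hr : 0 ≤ r)
    (h : dSR x y ≤ ENNReal.ofReal r) : |vert x y| ≤ r ^ 2 := by
  rw [← ENNReal.ofReal_le_ofReal_iff (by positivity), ENNReal.ofReal_pow hr]
  exact (ofReal_abs_vert_le_dSR_sq x y).trans (by gcongr)

/-- The central difference is `vert x y`, at most `r ^ 2`, plus a term at most `‖x‖ * r / 2`; the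
constant covers both coordinates at once. -/
theorem dist_le_of_dSR_le {x y : Heis n} {r : ℝ} (hr : 0 ≤ r) (h : dSR x y ≤ ENNReal.ofReal r) :
    dist x y ≤ (1 + ‖x‖ + r) * r := by
  have h1 := norm_fst_sub_le_of_dSR_le hr h
  have h2 := abs_vert_le_of_dSR_le hr h
  have hx : ‖x.1‖ ≤ ‖x‖ := norm_fst_le x
  have hx0 := norm_nonneg x
  rw [vert_eq] at h2
  have h3 : |inner ℝ (J x.1) (y.1 - x.1)| ≤ ‖x‖ * r :=
    (abs_inner_J_le _ _).trans (by gcongr)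
  rw [dist_comm, Prod.dist_eq, max_le_iff, dist_eq_norm, Real.dist_eq]
  constructor
  · nlinarith
  · rw [abs_le] at h2 h3 ⊢
    constructor <;> nlinarith

theorem eq_of_dSR_eq_zero {x y : Heis n} (h : dSR x y = 0) : x = y := by
  have := dist_le_of_dSR_le le_rfl (h.le.trans (by simp) : dSR x y ≤ ENNReal.ofReal 0)
  exact dist_le_zero.1 (by simpa using this)

/-! ### Upper bounds, finiteness and continuity of the distance -/

theorem dSR_le_of_hasDerivAt {f f' : ℝ → Heis n} {C : ℝ} (hf : ∀ t, HasDerivAt f (f' t) t)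
    (hc : Continuous f') (hh : ∀ t, f' t ∈ horizontalSpace (f t))
    (hC : ∀ t ∈ Icc (0 : ℝ) 1, ‖(f' t).1‖ ≤ C) : dSR (f 0) (f 1) ≤ ENNReal.ofReal C := by
  have hd : deriv f = f' := funext fun t => (hf t).deriv
  have hAC : AbsolutelyContinuousOnInterval f 0 1 := by
    refine ContDiffOn.absolutelyContinuousOnInterval (ContDiff.contDiffOn ?_)
    rw [contDiff_one_iff_deriv]
    exact ⟨fun t => (hf t).differentiableAt, hd ▸ hc⟩
  refine (dSR_le_of_unit hAC (Filter.Eventually.of_forall fun t => hd ▸ hh t)).trans ?_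
  calc ∫⁻ t in Icc (0 : ℝ) 1, ENNReal.ofReal ‖(deriv f t).1‖
      ≤ ∫⁻ _ in Icc (0 : ℝ) 1, ENNReal.ofReal C :=
        setLIntegral_mono measurable_const fun t ht =>
          ENNReal.ofReal_le_ofReal (by rw [hd]; exact hC t ht)
    _ = ENNReal.ofReal C := by simp

theorem dSR_line_le (x : Heis n) (w : EuclideanSpace ℝ (Fin n ⊕ Fin n)) :
    dSR x (x.1 + w, x.2 + 1 / 2 * inner ℝ (J x.1) w) ≤ ENNReal.ofReal ‖w‖ := by
  have := dSR_le_of_hasDerivAt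
    (f := fun t => (x.1 + t • w, x.2 + t * (1 / 2 * inner ℝ (J x.1) w)))
    (f' := fun _ => (w, 1 / 2 * inner ℝ (J x.1) w)) (C := ‖w‖) (fun t => ?_) continuous_const
    (fun t => ?_) fun t _ => le_rfl
  · simpa using this
  · refine HasDerivAt.prodMk ?_ ?_
    · simpa using ((hasDerivAt_id t).smul_const w).const_add x.1
    · simpa using ((hasDerivAt_id t).mul_const (1 / 2 * inner ℝ (J x.1) w)).const_add x.2
  · rw [mem_horizontalSpace_iff]
    simp [inner_add_left, inner_smul_left, inner_J_self]

/-- In the plane of `e` and `J e`, the loop `p = a (t - t²)`, `q = a s (t² - t³)` has `p q' - q p' =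
a² s t² (1 - t)²`. Its signed area, `a² s / 60`, is the central displacement. Such a plane exists
because `n ≠ 0`. -/
theorem dSR_loop_le [NeZero n] (x : Heis n) (a s : ℝ) (ha : 0 ≤ a) (hs : |s| ≤ 1) :
    dSR x (x.1, x.2 + a ^ 2 * s / 60) ≤ ENNReal.ofReal (2 * a) := by
  set e : EuclideanSpace ℝ (Fin n ⊕ Fin n) := EuclideanSpace.single (Sum.inl 0) 1 with he
  have hJJ : J (J e) = -e := by ext (i | i) <;> simp
  have hen : ‖e‖ = 1 := by simp [he]
  have hee : inner ℝ e e = (1 : ℝ) := by rw [real_inner_self_eq_norm_sq, hen]; norm_num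
  have hJe : inner ℝ (J e) (J e) = (1 : ℝ) := by
    rw [real_inner_self_eq_norm_sq, norm_J, hen]; norm_num
  have hJe0 : inner ℝ (J e) e = (0 : ℝ) := inner_J_self e
  have hJe0' : inner ℝ e (J e) = (0 : ℝ) := by rw [real_inner_comm, hJe0]
  have hp : ∀ t, HasDerivAt (fun t : ℝ => a * (t - t ^ 2)) (a * (1 - 2 * t)) t := fun t => by
    simpa using (((hasDerivAt_id t).sub (hasDerivAt_pow 2 t)).const_mul a)
  have hq : ∀ t, HasDerivAt (fun t : ℝ => a * s * (t ^ 2 - t ^ 3))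
      (a * s * (2 * t - 3 * t ^ 2)) t := fun t => by
    simpa using (((hasDerivAt_pow 2 t).sub (hasDerivAt_pow 3 t)).const_mul (a * s))
  have hr : ∀ t, HasDerivAt (fun t : ℝ => 1 / 2 * (a ^ 2 * s * (t ^ 3 / 3 - t ^ 4 / 2 + t ^ 5 / 5)))
      (1 / 2 * (a ^ 2 * s * (t ^ 2 - 2 * t ^ 3 + t ^ 4))) t := fun t => by
    have := ((((hasDerivAt_pow 3 t).div_const 3).sub ((hasDerivAt_pow 4 t).div_const 2)).add
      ((hasDerivAt_pow 5 t).div_const 5)).const_mul (1 / 2 * (a ^ 2 * s))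
    convert! this using 1
    · ext t; simp; ring
    · push_cast; ring
  set c1 : ℝ := 1 / 2 * inner ℝ (J x.1) e with hc1
  set c2 : ℝ := 1 / 2 * inner ℝ (J x.1) (J e) with hc2
  have := dSR_le_of_hasDerivAt
    (f := fun t => (x.1 + ((a * (t - t ^ 2)) • e + (a * s * (t ^ 2 - t ^ 3)) • J e),
      x.2 + (a * (t - t ^ 2) * c1 + a * s * (t ^ 2 - t ^ 3) * c2 +
        1 / 2 * (a ^ 2 * s * (t ^ 3 / 3 - t ^ 4 / 2 + t ^ 5 / 5)))))
    (f' := fun t => ((a * (1 - 2 * t)) • e + (a * s * (2 * t - 3 * t ^ 2)) • J e,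
      a * (1 - 2 * t) * c1 + a * s * (2 * t - 3 * t ^ 2) * c2 +
        1 / 2 * (a ^ 2 * s * (t ^ 2 - 2 * t ^ 3 + t ^ 4))))
    (C := 2 * a) (fun t => ?_) (by fun_prop) (fun t => ?_) fun t ht => ?_
  · simp only [ne_eq, OfNat.ofNat_ne_zero, not_false_eq_true, zero_pow, sub_self, mul_zero,
      zero_smul, add_zero, zero_mul, one_pow, zero_div] at this
    convert! this using 3
    ring
  · exact (((hp t).smul_const e).add ((hq t).smul_const (J e))).const_add x.1 |>.prodMk <|
      ((((hp t).mul_const c1).add ((hq t).mul_const c2)).add (hr t)).const_add x.2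
  · rw [mem_horizontalSpace_iff]
    simp only [map_add, map_smul, inner_add_left, inner_add_right, inner_smul_left,
      inner_smul_right, hJJ, inner_neg_left, hee, hJe, hJe0, hJe0', hc1, hc2,
      conj_trivial]
    ring
  · refine (norm_add_le _ _).trans ?_
    rw [norm_smul, norm_smul, norm_J, hen, Real.norm_eq_abs, Real.norm_eq_abs, abs_mul, abs_mul,
      abs_mul, abs_of_nonneg ha]
    have h1 : |1 - 2 * t| ≤ 1 := abs_le.2 ⟨by linarith [ht.2], by linarith [ht.1]⟩
    have h2 : |2 * t - 3 * t ^ 2| ≤ 1 := abs_le.2 ⟨by nlinarith [ht.1, ht.2], by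
      nlinarith [sq_nonneg (3 * t - 1)]⟩
    have h3 : |s| * |2 * t - 3 * t ^ 2| ≤ 1 := mul_le_one₀ hs (abs_nonneg _) h2
    nlinarith

/-- An upper bound for the distance that is continuous and vanishes on the diagonal. -/
def ccBound (x y : Heis n) : ℝ := ‖y.1 - x.1‖ + 2 * Real.sqrt (60 * |vert x y|)

theorem continuous_ccBound : Continuous fun p : Heis n × Heis n => ccBound p.1 p.2 := by
  have := continuous_vert (n := n)
  unfold ccBound
  fun_prop

theorem _root_.Continuous.ccBound {α : Type*} [TopologicalSpace α] {f g : α → Heis n}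
    (hf : Continuous f) (hg : Continuous g) : Continuous fun a => ccBound (f a) (g a) := by
  have h : Continuous fun a => (f a, g a) := hf.prodMk hg
  have h' := continuous_ccBound.comp h
  exact h'

theorem ccBound_self (x : Heis n) : ccBound x x = 0 := by simp [ccBound, vert_self]

theorem ccBound_nonneg (x y : Heis n) : 0 ≤ ccBound x y := by unfold ccBound; positivity

theorem dSR_le_ccBound [NeZero n] (x y : Heis n) : dSR x y ≤ ENNReal.ofReal (ccBound x y) := by
  -- A straight horizontal segment reaches `m`, which lies over the projection of `y`; a loop then
  -- corrects the central coordinate by `vert x y`, with `a ^ 2 = 60 * |vert x y|` and `s` its sign.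
  set m : Heis n := (x.1 + (y.1 - x.1), x.2 + 1 / 2 * inner ℝ (J x.1) (y.1 - x.1)) with hm
  have h1 : dSR x m ≤ ENNReal.ofReal ‖y.1 - x.1‖ := dSR_line_le x (y.1 - x.1)
  have h2 : dSR m y ≤ ENNReal.ofReal (2 * Real.sqrt (60 * |vert x y|)) := by
    have h := dSR_loop_le m (Real.sqrt (60 * |vert x y|)) (SignType.sign (vert x y))
      (Real.sqrt_nonneg _) (by rcases lt_trichotomy (vert x y) 0 with h | h | h <;> simp [h])
    convert! h using 2
    refine Prod.ext (by simp [hm]) ?_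
    rw [Real.sq_sqrt (by positivity), mul_assoc, abs_mul_sign, vert_eq, hm]
    ring
  rw [ccBound, ENNReal.ofReal_add (norm_nonneg _) (by positivity)]
  exact (dSR_triangle x m y).trans (add_le_add h1 h2)

theorem dSR_ne_top [NeZero n] (x y : Heis n) : dSR x y ≠ ∞ :=
  ne_top_of_le_ne_top ENNReal.ofReal_ne_top (dSR_le_ccBound x y)

theorem toReal_dSR_le [NeZero n] (x y x' y' : Heis n) :
    (dSR x y).toReal ≤ ccBound x x' + (dSR x' y').toReal + ccBound y' y := by
  rw [← ENNReal.ofReal_le_ofReal_iff (by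
    have := ccBound_nonneg x x'; have := ccBound_nonneg y' y; positivity),
    ENNReal.ofReal_toReal (dSR_ne_top x y), ENNReal.ofReal_add (by
      have := ccBound_nonneg x x'; positivity) (ccBound_nonneg _ _),
    ENNReal.ofReal_add (ccBound_nonneg _ _) ENNReal.toReal_nonneg,
    ENNReal.ofReal_toReal (dSR_ne_top x' y')]
  refine (dSR_triangle x x' y).trans ?_
  rw [add_assoc]
  exact add_le_add (dSR_le_ccBound _ _) <|
    (dSR_triangle x' y' y).trans (add_le_add le_rfl (dSR_le_ccBound _ _))

theorem continuous_toReal_dSR [NeZero n] :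
    Continuous fun p : Heis n × Heis n => (dSR p.1 p.2).toReal := by
  rw [continuous_iff_continuousAt]
  rintro ⟨x, y⟩
  have t1 : Filter.Tendsto (fun p : Heis n × Heis n =>
      (dSR x y).toReal - ccBound x p.1 - ccBound p.2 y) (nhds (x, y)) (nhds (dSR x y).toReal) := by
    have h : Continuous fun p : Heis n × Heis n =>
        (dSR x y).toReal - ccBound x p.1 - ccBound p.2 y :=
      (continuous_const.sub (continuous_const.ccBound continuous_fst)).sub
        (continuous_snd.ccBound continuous_const)
    have := h.tendsto (x, y)
    rwa [ccBound_self, ccBound_self, sub_zero, sub_zero] at this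
  have t2 : Filter.Tendsto (fun p : Heis n × Heis n =>
      ccBound p.1 x + (dSR x y).toReal + ccBound y p.2) (nhds (x, y))
      (nhds (dSR x y).toReal) := by
    have h : Continuous fun p : Heis n × Heis n =>
        ccBound p.1 x + (dSR x y).toReal + ccBound y p.2 :=
      ((continuous_fst.ccBound continuous_const).add continuous_const).add
        (continuous_const.ccBound continuous_snd)
    have := h.tendsto (x, y)
    rwa [ccBound_self, ccBound_self, zero_add, add_zero] at this
  refine tendsto_of_tendsto_of_tendsto_of_le_of_le t1 t2 (fun p => ?_) fun p =>
    toReal_dSR_le p.1 p.2 x y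
  have := toReal_dSR_le x y p.1 p.2
  exact sub_le_iff_le_add.2 (sub_le_iff_le_add'.2 (this.trans_eq (add_assoc _ _ _)))

theorem continuous_dSR [NeZero n] : Continuous fun p : Heis n × Heis n => dSR p.1 p.2 := by
  have := ENNReal.continuous_ofReal.comp (continuous_toReal_dSR (n := n))
  refine this.congr fun p => ENNReal.ofReal_toReal (dSR_ne_top _ _)

/-! ### From control of the distance to horizontality -/

theorem dSR_le_lengthSR {σ : PathSpace n} (hσ : IsHorizontal σ) : dSR (σ 0) (σ 1) ≤ lengthSR σ :=
  iInf₂_le σ ⟨hσ, rfl, rfl⟩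

/-- The velocity of a curve of finite length at a point where the curve and a control `v` of its
length are differentiable. -/
theorem horizontal_of_hasDerivAt {f : ℝ → Heis n} {v : ℝ → ℝ} {D : Heis n} {v' t b : ℝ}
    (htb : t < b) (hmono : MonotoneOn v (Icc t b)) (hf : HasDerivAt f D t) (hv : HasDerivAt v v' t)
    (h : ∀ s ∈ Icc t b, dSR (f t) (f s) ≤ ENNReal.ofReal (v s - v t)) :
    D ∈ horizontalSpace (f t) ∧ ‖D.1‖ ≤ v' := by
  have hpos : ∀ᶠ e in nhdsWithin (0 : ℝ) (Ioi 0), 0 < e ∧ t + e ∈ Icc t b := by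
    filter_upwards [Ioo_mem_nhdsGT (sub_pos.2 htb)] with e he
    exact ⟨he.1, by linarith [he.1], by linarith [he.2]⟩
  have hvt := hv.tendsto_slope_zero_right
  have hv0 : Filter.Tendsto (fun e => v (t + e) - v t) (nhdsWithin (0 : ℝ) (Ioi 0)) (nhds 0) := by
    have h1 : Filter.Tendsto (fun e : ℝ => e * (e⁻¹ • (v (t + e) - v t)))
        (nhdsWithin (0 : ℝ) (Ioi 0)) (nhds (0 * v')) :=
      (Filter.tendsto_id.mono_left nhdsWithin_le_nhds).mul hvt
    rw [zero_mul] at h1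
    refine h1.congr' ?_
    filter_upwards [hpos] with e he
    rw [smul_eq_mul, mul_inv_cancel_left₀ he.1.ne']
  have hnn : ∀ s ∈ Icc t b, 0 ≤ v s - v t := fun s hs =>
    sub_nonneg.2 (hmono (left_mem_Icc.2 htb.le) hs hs.1)
  constructor
  · rw [mem_horizontalSpace_iff]
    -- The kernel of `A` is the horizontal space at `f t`.
    set A : Heis n →L[ℝ] ℝ := ContinuousLinearMap.snd ℝ _ _ - (1 / 2 : ℝ) •
      (innerSL ℝ (J (f t).1)).comp (ContinuousLinearMap.fst ℝ _ _) with hA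
    have hA' : ∀ w, A w = w.2 - 1 / 2 * inner ℝ (J (f t).1) w.1 := fun w => by simp [hA]
    have hAf := (A.hasFDerivAt.comp_hasDerivAt t hf).tendsto_slope_zero_right
    have hlim := hvt.mul hv0
    rw [mul_zero] at hlim
    -- The difference quotient of `A ∘ f` is at most `(v (t + e) - v t) ^ 2 / e`, the product of a
    -- convergent quotient and a vanishing increment.
    have : ‖A D‖ ≤ 0 := by
      refine le_of_tendsto_of_tendsto hAf.norm hlim ?_
      filter_upwards [hpos] with e he
      have hvert : A (f (t + e)) - A (f t) = vert (f t) (f (t + e)) := by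
        rw [hA', hA', inner_J_self, vert]; ring
      simp only [Function.comp_apply]
      rw [hvert, norm_smul, norm_inv, Real.norm_of_nonneg he.1.le, smul_eq_mul, mul_assoc, ← sq]
      exact mul_le_mul_of_nonneg_left (abs_vert_le_of_dSR_le (hnn _ he.2) (h _ he.2))
        (inv_nonneg.2 he.1.le)
    have h0 : A D = 0 := norm_le_zero_iff.1 this
    rw [hA'] at h0
    linarith
  · have hf1 := ((ContinuousLinearMap.fst ℝ (EuclideanSpace ℝ (Fin n ⊕ Fin n))
      ℝ).hasFDerivAt.comp_hasDerivAt t hf).tendsto_slope_zero_right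
    refine le_of_tendsto_of_tendsto hf1.norm hvt ?_
    filter_upwards [hpos] with e he
    simp only [Function.comp_apply, ContinuousLinearMap.coe_fst']
    rw [norm_smul, norm_inv, Real.norm_of_nonneg he.1.le, smul_eq_mul]
    exact mul_le_mul_of_nonneg_left (norm_fst_sub_le_of_dSR_le (hnn _ he.2) (h _ he.2))
      (inv_nonneg.2 he.1.le)

/-- An absolutely continuous curve whose length is controlled by a monotone function is
horizontal. -/
theorem IsAC.isHorizontal_of_dSR_le {σ : PathSpace n} (hσ : IsAC σ) {v : ℝ → ℝ}
    (hmono : MonotoneOn v (Icc 0 1))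
    (h : ∀ s ∈ Icc (0 : ℝ) 1, ∀ t ∈ Icc (0 : ℝ) 1, s ≤ t →
      dSR (extend σ s) (extend σ t) ≤ ENNReal.ofReal (v t - v s)) :
    IsHorizontal σ ∧ lengthSR σ ≤ ENNReal.ofReal (v 1 - v 0) := by
  have hmono' : MonotoneOn v (uIcc 0 1) := by rwa [uIcc_of_le zero_le_one]
  have key : ∀ᵐ t ∂volume.restrict (Icc (0 : ℝ) 1),
      deriv (extend σ) t ∈ horizontalSpace (extend σ t) ∧ ‖(deriv (extend σ) t).1‖ ≤ deriv v t := by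
    rw [ae_Icc_iff_Ioo, ae_restrict_iff' measurableSet_Ioo]
    filter_upwards [AbsolutelyContinuousOnInterval.boundedVariationOn hσ
      |>.ae_differentiableAt_of_mem_uIcc, hmono.ae_differentiableWithinAt_of_mem] with t h1 h2 ht
    have htI := Ioo_subset_Icc_self ht
    rw [uIcc_of_le zero_le_one] at h1
    exact horizontal_of_hasDerivAt ht.2 (hmono.mono (Icc_subset_Icc_left ht.1.le))
      (h1 htI).hasDerivAt ((h2 htI).differentiableAt (Icc_mem_nhds ht.1 ht.2)).hasDerivAt
      fun s hs => h t htI s ⟨ht.1.le.trans hs.1, hs.2⟩ hs.1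
  refine ⟨⟨hσ, key.mono fun t ht => ht.1⟩, ?_⟩
  have hint := hmono'.intervalIntegrable_deriv
  rw [intervalIntegrable_iff_integrableOn_Icc_of_le zero_le_one] at hint
  -- For a merely monotone `v` the integral of the derivative may be smaller than the increment;
  -- only this inequality is needed.
  have hle := hmono'.intervalIntegral_deriv_mem_uIcc
  rw [uIcc_of_le (sub_nonneg.2 (hmono (by simp) (by simp) zero_le_one)),
    intervalIntegral.integral_of_le zero_le_one, ← integral_Icc_eq_integral_Ioc] at hle
  calc lengthSR σ ≤ ∫⁻ t in Icc (0 : ℝ) 1, ENNReal.ofReal (deriv v t) :=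
        lintegral_mono_ae (key.mono fun t ht => ENNReal.ofReal_le_ofReal ht.2)
    _ = ENNReal.ofReal (∫ t in Icc (0 : ℝ) 1, deriv v t) :=
        (ofReal_integral_eq_lintegral_ofReal hint
          (key.mono fun t ht => (norm_nonneg _).trans ht.2)).symm
    _ ≤ _ := ENNReal.ofReal_le_ofReal hle.2

/-! ### Metric length against sub-Riemannian length -/

theorem dSR_le_setLIntegral {σ : PathSpace n} (hσ : IsHorizontal σ) {s t : unitInterval}
    (hst : s ≤ t) :
    dSR (σ s) (σ t) ≤
      ∫⁻ r in Ioc (s : ℝ) t, ENNReal.ofReal (horizontalNorm (deriv (extend σ) r)) := by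
  rcases hst.eq_or_lt with rfl | hlt
  · simp [dSR_self]
  have hsub : Icc (s : ℝ) t ⊆ Icc 0 1 := Icc_subset_Icc s.2.1 t.2.2
  rw [← extend_coe, ← extend_coe, restrict_Ioc_eq_restrict_Icc]
  refine dSR_le_lintegral hlt (AbsolutelyContinuousOnInterval.mono hσ.1 ?_) (ae_mono
    (Measure.restrict_mono hsub le_rfl) hσ.2)
  rwa [uIcc_of_le zero_le_one, uIcc_of_le (show (s : ℝ) ≤ t from hst)]

theorem sum_le_of_superadditive {k : ℕ} {t : Fin (k + 1) → unitInterval} (ht : Monotone t)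
    {m : unitInterval → unitInterval → ℝ≥0∞}
    (hm : ∀ a b c, a ≤ b → b ≤ c → m a b + m b c ≤ m a c) :
    ∑ i : Fin k, m (t i.castSucc) (t i.succ) ≤ m (t 0) (t (Fin.last k)) := by
  induction k with
  | zero => simp
  | succ k ih =>
    rw [Fin.sum_univ_castSucc]
    refine (add_le_add (ih (t := fun i => t i.castSucc)
      (ht.comp Fin.strictMono_castSucc.monotone)) le_rfl).trans ?_
    exact hm _ _ _ (ht (by simp)) (ht (Fin.le_last _))

/-- A partition is carried by `φ` to consecutive, possibly degenerate, intervals, over which the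
integrals of the speed add up. -/
theorem length_comp_le {η : PathSpace n} (hη : IsHorizontal η) {φ : C(unitInterval, unitInterval)}
    (hφ : Monotone φ) : length (η.comp φ) ≤ lengthSR η := by
  set g : ℝ → ℝ≥0∞ := fun r => ENNReal.ofReal (horizontalNorm (deriv (extend η) r)) with hg
  refine iSup_le fun k => iSup₂_le fun t ht => ?_
  calc ∑ i : Fin k, dSR (η (φ (t i.castSucc))) (η (φ (t i.succ)))
      ≤ ∑ i : Fin k, ∫⁻ r in Ioc (φ (t i.castSucc) : ℝ) (φ (t i.succ)), g r :=
        Finset.sum_le_sum fun i _ =>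
          dSR_le_setLIntegral hη (hφ (ht.1.monotone (Fin.castSucc_lt_succ (i := i)).le))
    _ ≤ ∫⁻ r in Ioc (φ (t 0) : ℝ) (φ (t (Fin.last k))), g r := by
        refine sum_le_of_superadditive ht.1.monotone
          (m := fun a b => ∫⁻ r in Ioc (φ a : ℝ) (φ b), g r) fun a b c hab hbc => ?_
        rw [← lintegral_union measurableSet_Ioc (Ioc_disjoint_Ioc_of_le le_rfl),
          Ioc_union_Ioc_eq_Ioc (show (φ a : ℝ) ≤ φ b from hφ hab) (show (φ b : ℝ) ≤ φ c from hφ hbc)]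
    _ ≤ lengthSR η :=
        lintegral_mono_set ((Ioc_subset_Icc_self).trans (Icc_subset_Icc (φ _).2.1 (φ _).2.2))

theorem sum_le_length (σ : PathSpace n) {k : ℕ} {t : Fin (k + 1) → unitInterval}
    (ht : StrictMono t) (h0 : t 0 = 0) (h1 : t (Fin.last k) = 1) :
    ∑ i : Fin k, dSR (σ (t i.castSucc)) (σ (t i.succ)) ≤ length σ :=
  le_iSup_of_le k (le_iSup₂_of_le t ⟨ht, h0, h1⟩ le_rfl)

theorem dSR_le_length (σ : PathSpace n) : dSR (σ 0) (σ 1) ≤ length σ := by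
  have := sum_le_length σ (t := ![0, 1])
    (by simp [Fin.strictMono_iff_lt_succ]) rfl rfl
  simpa using this

theorem dSR_add_le_length (σ : PathSpace n) (s : unitInterval) :
    dSR (σ 0) (σ s) + dSR (σ s) (σ 1) ≤ length σ := by
  rcases (unitInterval.nonneg' (t := s)).eq_or_lt with rfl | h0
  · simpa [dSR_self] using dSR_le_length σ
  rcases (unitInterval.le_one' (t := s)).eq_or_lt with rfl | h1
  · simpa [dSR_self] using dSR_le_length σ
  have := sum_le_length σ (t := ![0, s, 1])
    (by simp [Fin.strictMono_iff_lt_succ, Fin.forall_fin_succ, h0, h1]) rfl rfl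
  simpa [Fin.sum_univ_succ] using this

theorem dSR_add_add_le_length (σ : PathSpace n) {s t : unitInterval} (hst : s ≤ t) :
    dSR (σ 0) (σ s) + dSR (σ s) (σ t) + dSR (σ t) (σ 1) ≤ length σ := by
  rcases hst.eq_or_lt with rfl | hst
  · simpa [dSR_self] using dSR_add_le_length σ s
  rcases (unitInterval.nonneg' (t := s)).eq_or_lt with rfl | h0
  · simpa [dSR_self] using dSR_add_le_length σ t
  rcases (unitInterval.le_one' (t := t)).eq_or_lt with rfl | h1
  · simpa [dSR_self] using dSR_add_le_length σ s
  have := sum_le_length σ (t := ![0, s, t, 1])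
    (by simp [Fin.strictMono_iff_lt_succ, Fin.forall_fin_succ, h0, h1, hst]) rfl rfl
  simpa [Fin.sum_univ_succ, add_assoc] using this

/-! ### Reparametrization and constant speed -/

/-- Reparametrization of a curve by a continuous control of its length. -/
theorem exists_reparam {σ : unitInterval → Heis n} {v : unitInterval → ℝ} (hv : Continuous v)
    (hmono : Monotone v) (hv0 : v 0 = 0)
    (h : ∀ s t, s ≤ t → dSR (σ s) (σ t) ≤ ENNReal.ofReal (v t - v s)) :
    ∃ (η : unitInterval → Heis n) (φ : C(unitInterval, unitInterval)),
      (∀ s t : unitInterval, s ≤ t → dSR (η s) (η t) ≤ ENNReal.ofReal ((t - s) * v 1)) ∧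
      Monotone φ ∧ φ 0 = 0 ∧ φ 1 = 1 ∧ ∀ t, σ t = η (φ t) := by
  have hnn : ∀ t, 0 ≤ v t := fun t => hv0 ▸ hmono unitInterval.nonneg'
  rcases (hnn 1).eq_or_lt with h1 | hL
  -- If `v 1 = 0` the control vanishes identically and normalization is impossible, but `σ` already
  -- has speed zero.
  · refine ⟨σ, ContinuousMap.id _, fun s t hst => ?_, monotone_id, rfl, rfl, fun t => rfl⟩
    refine (h s t hst).trans ?_
    rw [← h1, mul_zero]
    refine ENNReal.ofReal_le_ofReal ?_
    linarith [hnn s, hmono (unitInterval.le_one' (t := t))]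
  set φ : C(unitInterval, unitInterval) :=
    ⟨fun t => ⟨v t / v 1, div_nonneg (hnn t) hL.le,
      div_le_one_of_le₀ (hmono unitInterval.le_one') hL.le⟩, by fun_prop⟩ with hφ
  have hφv : ∀ t, v t = φ t * v 1 := fun t => by simp [hφ, hL.ne']
  have hφmono : Monotone φ := fun s t hst => by
    change v s / v 1 ≤ v t / v 1
    gcongr
    exact hmono hst
  have hφ0 : φ 0 = 0 := Subtype.ext (by simp [hφ, hv0])
  have hφ1 : φ 1 = 1 := Subtype.ext (by simp [hφ, hL.ne'])
  have hle : ∀ s t, φ s ≤ φ t → dSR (σ s) (σ t) ≤ ENNReal.ofReal ((φ t - φ s) * v 1) := by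
    intro s t hst
    rcases le_total s t with hle | hle
    · refine (h s t hle).trans_eq ?_
      rw [hφv s, hφv t, sub_mul]
    · have heq : φ s = φ t := le_antisymm hst (hφmono hle)
      have h0 := h t s hle
      rw [hφv s, hφv t, heq, sub_self, ENNReal.ofReal_zero] at h0
      rw [eq_of_dSR_eq_zero (le_antisymm h0 zero_le), dSR_self]
      exact zero_le
  have heq : ∀ s t, φ s = φ t → σ s = σ t := fun s t hst => by
    have := hle s t hst.le
    rw [hst, sub_self, zero_mul, ENNReal.ofReal_zero] at this
    exact eq_of_dSR_eq_zero (le_antisymm this zero_le)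
  have hsurj : Function.Surjective φ := fun u => by
    have := intermediate_value_univ (0 : unitInterval) 1 φ.continuous
    rw [hφ0, hφ1] at this
    exact this ⟨unitInterval.nonneg', unitInterval.le_one'⟩
  -- Any right inverse of `φ` serves, continuous or not, because `σ` is constant on the fibres of
  -- `φ`.
  choose ψ hψ using hsurj
  refine ⟨fun u => σ (ψ u), φ, fun s t hst => ?_, hφmono, hφ0, hφ1, fun t => ?_⟩
  · have := hle (ψ s) (ψ t) (by rwa [hψ, hψ])
    rwa [hψ, hψ] at this
  · exact heq _ _ (hψ _).symm

/-- A Lipschitz constant, for the Euclidean distance, of curves that start in the ball of radius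
`a` and are `L`-Lipschitz for the sub-Riemannian distance. -/
def lipConst (a L : ℝ) : ℝ := (1 + (a + (1 + a + L) * L) + L) * L

theorem norm_le_of_dSR_lipschitz {f : unitInterval → Heis n} {a L : ℝ} (hL : 0 ≤ L)
    (ha : ‖f 0‖ ≤ a)
    (h : ∀ s t : unitInterval, s ≤ t → dSR (f s) (f t) ≤ ENNReal.ofReal ((t - s) * L))
    (t : unitInterval) : ‖f t‖ ≤ a + (1 + a + L) * L := by
  have h1 : dSR (f 0) (f t) ≤ ENNReal.ofReal L := (h 0 t unitInterval.nonneg').trans <| by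
    refine ENNReal.ofReal_le_ofReal ?_
    have := t.2.2
    simp only [Icc.coe_zero, sub_zero]
    nlinarith
  have h2 := dist_le_of_dSR_le hL h1
  have h3 := norm_le_norm_add_norm_sub' (f t) (f 0)
  rw [← dist_eq_norm, dist_comm] at h3
  nlinarith [norm_nonneg (f 0)]

/-- The constant of `dist_le_of_dSR_le` depends on the base point; the bound on the norm along the
curve makes it uniform. -/
theorem dist_le_of_dSR_lipschitz {f : unitInterval → Heis n} {a L : ℝ} (hL : 0 ≤ L)
    (ha : ‖f 0‖ ≤ a)
    (h : ∀ s t : unitInterval, s ≤ t → dSR (f s) (f t) ≤ ENNReal.ofReal ((t - s) * L))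
    (s t : unitInterval) : dist (f s) (f t) ≤ lipConst a L * dist s t := by
  wlog hst : s ≤ t generalizing s t
  · rw [dist_comm, dist_comm s]; exact this t s (le_of_not_ge hst)
  have hst' : (s : ℝ) ≤ t := hst
  have hr : 0 ≤ ((t : ℝ) - s) * L := mul_nonneg (sub_nonneg.2 hst') hL
  have hrL : ((t : ℝ) - s) * L ≤ L := by nlinarith [t.2.2, s.2.1]
  refine (dist_le_of_dSR_le hr (h s t hst)).trans ?_
  rw [dist_comm, Subtype.dist_eq, Real.dist_eq, abs_of_nonneg (sub_nonneg.2 hst'), lipConst,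
    mul_assoc, mul_comm L]
  have := norm_le_of_dSR_lipschitz hL ha h s
  gcongr

theorem lipConst_nonneg {a L : ℝ} (ha : 0 ≤ a) (hL : 0 ≤ L) : 0 ≤ lipConst a L := by
  unfold lipConst; positivity

/-- The functions that are Lipschitz for the sub-Riemannian distance with the least constant their
end points allow. -/
def IsConstSpeed (f : unitInterval → Heis n) : Prop :=
  ∀ s t : unitInterval, s ≤ t →
    dSR (f s) (f t) ≤ ENNReal.ofReal ((t - s) * (dSR (f 0) (f 1)).toReal)

theorem IsConstSpeed.lipschitzWith {f : unitInterval → Heis n} (hf : IsConstSpeed f) :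
    LipschitzWith (lipConst ‖f 0‖ (dSR (f 0) (f 1)).toReal).toNNReal f :=
  LipschitzWith.of_dist_le_mul fun s t => by
    rw [Real.coe_toNNReal _ (lipConst_nonneg (norm_nonneg _) ENNReal.toReal_nonneg)]
    exact dist_le_of_dSR_lipschitz ENNReal.toReal_nonneg le_rfl hf s t

theorem IsConstSpeed.isMinimizingHorizontal [NeZero n] {σ : PathSpace n} (hσ : IsConstSpeed σ) :
    IsMinimizingHorizontal σ := by
  have hAC : IsAC σ := by
    refine LipschitzOnWith.absolutelyContinuousOnInterval
      (K := (lipConst ‖σ 0‖ (dSR (σ 0) (σ 1)).toReal).toNNReal) ?_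
    rw [uIcc_of_le zero_le_one]
    intro s hs t ht
    have := hσ.lipschitzWith ⟨s, hs⟩ ⟨t, ht⟩
    rwa [← extend_coe, ← extend_coe] at this
  have := hAC.isHorizontal_of_dSR_le (v := fun t => t * (dSR (σ 0) (σ 1)).toReal)
    (fun s _ t _ hst => by dsimp only; gcongr) fun s hs t ht hst => by
      have := hσ ⟨s, hs⟩ ⟨t, ht⟩ hst
      rwa [← extend_coe, ← extend_coe, sub_mul] at this
  refine ⟨this.1, le_antisymm ?_ (dSR_le_lengthSR this.1)⟩
  simpa [ENNReal.ofReal_toReal (dSR_ne_top _ _)] using this.2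

/-! ### Curves whose length is the distance of their end points -/

/-- The partition through `s` and `t` has sum at most `dSR (σ 0) (σ 1)`. Comparing with the triangle
inequality through `σ t` and cancelling the finite last term leaves additivity up to time `t`. -/
theorem dSR_le_of_length_eq [NeZero n] {σ : PathSpace n} (h : length σ = dSR (σ 0) (σ 1))
    {s t : unitInterval} (hst : s ≤ t) :
    dSR (σ s) (σ t) ≤
      ENNReal.ofReal ((dSR (σ 0) (σ t)).toReal - (dSR (σ 0) (σ s)).toReal) := by
  have h1 := dSR_add_add_le_length σ hst
  rw [h] at h1
  have h2 := h1.trans (dSR_triangle (σ 0) (σ t) (σ 1))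
  rw [ENNReal.add_le_add_iff_right (dSR_ne_top _ _)] at h2
  rw [← ENNReal.ofReal_toReal (dSR_ne_top (σ s) (σ t))]
  refine ENNReal.ofReal_le_ofReal ?_
  have h3 := ENNReal.toReal_mono (dSR_ne_top _ _) h2
  rw [ENNReal.toReal_add (dSR_ne_top _ _) (dSR_ne_top _ _)] at h3
  linarith

theorem toReal_dSR_mono_of_length_eq [NeZero n] {σ : PathSpace n}
    (h : length σ = dSR (σ 0) (σ 1)) : Monotone fun t => (dSR (σ 0) (σ t)).toReal := by
  intro s t hst
  have h1 := dSR_add_add_le_length σ hst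
  rw [h] at h1
  have h2 := h1.trans (dSR_triangle (σ 0) (σ t) (σ 1))
  rw [ENNReal.add_le_add_iff_right (dSR_ne_top _ _)] at h2
  exact ENNReal.toReal_mono (dSR_ne_top _ _) (le_self_add.trans h2)

/-- The curves whose length is the distance of their end points are the reparametrizations of
minimizing horizontal curves. -/
theorem length_eq_dSR_iff [NeZero n] {σ : PathSpace n} :
    length σ = dSR (σ 0) (σ 1) ↔ IsReparamOfMinimizingHorizontal σ := by
  constructor
  · intro h
    have hcont : Continuous fun t => (dSR (σ 0) (σ t)).toReal := by
      have h1 : Continuous fun t => (σ 0, σ t) := by fun_prop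
      have h2 := (continuous_toReal_dSR (n := n)).comp h1
      exact h2
    obtain ⟨η, φ, hη, hφ, h0, h1, hσ⟩ := exists_reparam hcont (toReal_dSR_mono_of_length_eq h)
      (by simp [dSR_self]) fun s t hst => dSR_le_of_length_eq h hst
    have hη0 : η 0 = σ 0 := by rw [hσ, h0]
    have hη1 : η 1 = σ 1 := by rw [hσ, h1]
    have hspeed : IsConstSpeed η := fun s t hst => by rw [hη0, hη1]; exact hη s t hst
    refine ⟨⟨η, hspeed.lipschitzWith.continuous⟩, φ,
      IsConstSpeed.isMinimizingHorizontal (σ := ⟨η, _⟩) hspeed, hφ, h0, h1, ?_⟩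
    ext1 t
    exact hσ t
  · rintro ⟨η, φ, hη, hφ, h0, h1, rfl⟩
    refine le_antisymm ((length_comp_le hη.1 hφ).trans_eq ?_) (dSR_le_length _)
    rw [hη.2, ContinuousMap.comp_apply, ContinuousMap.comp_apply, h0, h1]

theorem IsMinimizingHorizontal.isReparam {σ : PathSpace n} (hσ : IsMinimizingHorizontal σ) :
    IsReparamOfMinimizingHorizontal σ :=
  ⟨σ, ContinuousMap.id _, hσ, monotone_id, rfl, rfl, rfl⟩

/-- The control is `t ↦ dSR (σ 0) (σ t)`, whose total increase is the distance of the end points;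
absolute continuity of `σ` replaces the change of parameter. -/
theorem IsReparamOfMinimizingHorizontal.isMinimizingHorizontal [NeZero n] {σ : PathSpace n}
    (hσ : IsReparamOfMinimizingHorizontal σ) (hAC : IsAC σ) : IsMinimizingHorizontal σ := by
  have h := length_eq_dSR_iff.2 hσ
  have hmono := toReal_dSR_mono_of_length_eq h
  have := hAC.isHorizontal_of_dSR_le (v := fun t => (dSR (σ 0) (extend σ t)).toReal)
    (fun s hs t ht hst => by
      have := hmono (show (⟨s, hs⟩ : unitInterval) ≤ ⟨t, ht⟩ from hst)
      dsimp only at this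
      rwa [← extend_coe σ ⟨s, hs⟩, ← extend_coe σ ⟨t, ht⟩] at this) fun s hs t ht hst => by
      have := dSR_le_of_length_eq h (show (⟨s, hs⟩ : unitInterval) ≤ ⟨t, ht⟩ from hst)
      rwa [← extend_coe σ ⟨s, hs⟩, ← extend_coe σ ⟨t, ht⟩] at this
  refine ⟨this.1, le_antisymm ?_ (dSR_le_lengthSR this.1)⟩
  simpa [extend_zero, extend_one, dSR_self, ENNReal.ofReal_toReal (dSR_ne_top _ _)] using this.2

/-! ### Existence of geodesics -/

/-- Curves that almost minimize, parametrized with almost constant speed. -/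
theorem exists_almost_geodesic {x y : Heis n} {M : ℝ} (hM : dSR x y < ENNReal.ofReal M) :
    ∃ f : unitInterval → Heis n, f 0 = x ∧ f 1 = y ∧
      ∀ s t : unitInterval, s ≤ t → dSR (f s) (f t) ≤ ENNReal.ofReal ((t - s) * M) := by
  obtain ⟨σ, hσM⟩ := iInf_lt_iff.1 hM
  obtain ⟨⟨hσ, rfl, rfl⟩, hlen⟩ := iInf_lt_iff.1 hσM
  set g : ℝ → ℝ := fun r => horizontalNorm (deriv (extend σ) r) with hg
  have hg0 : ∀ r, 0 ≤ g r := fun r => norm_nonneg _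
  have hgm : Measurable g := (measurable_deriv _).fst.norm
  have hgi : IntegrableOn g (Icc 0 1) := by
    refine ⟨hgm.aestronglyMeasurable, ?_⟩
    rw [hasFiniteIntegral_iff_ofReal (Filter.Eventually.of_forall hg0)]
    exact hlen.trans ENNReal.ofReal_lt_top
  have hgi' : ∀ s t : unitInterval, IntervalIntegrable g volume s t := fun s t =>
    (hgi.mono_set (uIcc_subset_Icc s.2 t.2)).intervalIntegrable
  set v : unitInterval → ℝ := fun t => ∫ r in (0 : ℝ)..t, g r with hv
  have hvsub : ∀ s t : unitInterval, v t - v s = ∫ r in (s : ℝ)..t, g r := fun s t =>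
    intervalIntegral.integral_interval_sub_left (hgi' 0 t) (hgi' 0 s)
  have hcont : Continuous v := by
    have := intervalIntegral.continuousOn_primitive_interval (a := 0) (b := 1) (μ := volume)
      (f := g) (by rwa [uIcc_of_le zero_le_one])
    rw [uIcc_of_le zero_le_one] at this
    exact this.comp_continuous continuous_subtype_val fun t => t.2
  have hmono : Monotone v := fun s t hst => by
    rw [← sub_nonneg, hvsub]
    exact intervalIntegral.integral_nonneg hst fun r _ => hg0 r
  have hofReal : ∀ s t : unitInterval, s ≤ t → ENNReal.ofReal (v t - v s) =
      ∫⁻ r in Ioc (s : ℝ) t, ENNReal.ofReal (g r) := fun s t hst => by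
    rw [hvsub, intervalIntegral.integral_of_le hst, ofReal_integral_eq_lintegral_ofReal
      ((hgi.mono_set (Ioc_subset_Icc_self.trans (Icc_subset_Icc s.2.1 t.2.2))))
      (Filter.Eventually.of_forall hg0)]
  have hv0 : v 0 = 0 := by simp [hv]
  have hd : ∀ s t, s ≤ t → dSR (σ s) (σ t) ≤ ENNReal.ofReal (v t - v s) := fun s t hst =>
    (dSR_le_setLIntegral hσ hst).trans_eq (hofReal s t hst).symm
  obtain ⟨η, φ, hη, -, h0, h1, hση⟩ := exists_reparam hcont hmono hv0 hd
  have hv1 : v 1 ≤ M := by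
    have h := hofReal 0 1 zero_le_one
    rw [hv0, sub_zero] at h
    have h' : ENNReal.ofReal (v 1) < ENNReal.ofReal M :=
      (h.trans_le (lintegral_mono_set Ioc_subset_Icc_self)).trans_lt hlen
    exact ((ENNReal.ofReal_lt_ofReal_iff_of_nonneg (hv0 ▸ hmono zero_le_one)).1 h').le
  refine ⟨η, by rw [hση, h0], by rw [hση, h1], fun s t hst => (hη s t hst).trans ?_⟩
  have : (0 : ℝ) ≤ t - s := sub_nonneg.2 hst
  gcongr

/-- Any two points are joined by a curve of constant speed. -/
theorem exists_isConstSpeed [NeZero n] (x y : Heis n) :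
    ∃ σ : PathSpace n, σ 0 = x ∧ σ 1 = y ∧ IsConstSpeed σ := by
  set L := (dSR x y).toReal with hL
  have hL0 : 0 ≤ L := ENNReal.toReal_nonneg
  -- The bounds `M k` decrease to `L`, so the sets `S k` are nested and a point of their
  -- intersection has constant speed.
  set M : ℕ → ℝ := fun k => L + 1 / (k + 1) with hMdef
  set S : ℕ → Set (unitInterval → Heis n) := fun k => {f | f 0 = x ∧ f 1 = y ∧
    ∀ s t : unitInterval, s ≤ t → dSR (f s) (f t) ≤ ENNReal.ofReal ((t - s) * M k)} with hS
  have hclosed : ∀ k, IsClosed (S k) := fun k => by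
    have hd : ∀ s t : unitInterval, Continuous fun f : unitInterval → Heis n =>
        dSR (f s) (f t) := fun s t => by
      have h1 : Continuous fun f : unitInterval → Heis n => (f s, f t) := by fun_prop
      have h2 := (continuous_dSR (n := n)).comp h1
      exact h2
    simp only [hS, ofPred_and, ofPred_forall]
    refine (isClosed_eq (continuous_apply _) continuous_const).inter
      ((isClosed_eq (continuous_apply _) continuous_const).inter ?_)
    exact isClosed_iInter fun s => isClosed_iInter fun t => isClosed_iInter fun _ =>
      isClosed_le (hd s t) continuous_const
  -- Tychonoff for pointwise convergence suffices: the conditions involve finitely many times each,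
  -- and continuity of the limit follows from constant speed.
  have hcompact : IsCompact (S 0) := by
    refine IsCompact.of_isClosed_subset (isCompact_univ_pi fun _ : unitInterval =>
      isCompact_closedBall (0 : Heis n) (‖x‖ + (1 + ‖x‖ + M 0) * M 0)) (hclosed 0)
      fun f hf t _ => ?_
    rw [mem_closedBall_zero_iff]
    exact norm_le_of_dSR_lipschitz (by simp only [hMdef]; positivity) (by rw [hf.1]) hf.2.2 t
  have hne : (⋂ k, S k).Nonempty := by
    refine IsCompact.nonempty_iInter_of_sequence_nonempty_isCompact_isClosed S
      (fun k f hf => ⟨hf.1, hf.2.1, fun s t hst => (hf.2.2 s t hst).trans ?_⟩) (fun k => ?_)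
      hcompact hclosed
    · have : (0 : ℝ) ≤ t - s := sub_nonneg.2 hst
      simp only [hMdef]
      push_cast
      gcongr
      linarith
    · refine exists_almost_geodesic ?_
      rw [ENNReal.lt_ofReal_iff_toReal_lt (dSR_ne_top _ _)]
      simp only [hMdef, ← hL]
      have : (0 : ℝ) < 1 / (k + 1) := by positivity
      linarith
  obtain ⟨f, hf⟩ := hne
  rw [mem_iInter] at hf
  have hf0 := (hf 0).1
  have hf1 := (hf 0).2.1
  have hspeed : IsConstSpeed f := fun s t hst => by
    rw [hf0, hf1, ← hL]
    refine ge_of_tendsto' (f := fun k => ENNReal.ofReal ((t - s) * M k)) (x := Filter.atTop) ?_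
      fun k => (hf k).2.2 s t hst
    refine ENNReal.tendsto_ofReal (Filter.Tendsto.const_mul _ ?_)
    simpa [hMdef] using tendsto_one_div_add_atTop_nhds_zero_nat.const_add L
  exact ⟨⟨f, hspeed.lipschitzWith.continuous⟩, hf0, hf1, hspeed⟩

end Heisenberg

/-! ### Lifting a measure through a continuous map -/

open scoped BoundedContinuousFunction in
/-- A finite measure carried by the range of a continuous map on a compact space is the image of a
finite measure. -/
theorem MeasureTheory.Measure.exists_map_eq_of_compactSpace {X Y : Type*} [TopologicalSpace X]
    [CompactSpace X] [T2Space X] [MeasurableSpace X] [BorelSpace X] [TopologicalSpace Y]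
    [MeasurableSpace Y] [BorelSpace Y] [HasOuterApproxClosed Y] {E : X → Y} (hE : Continuous E)
    (γ : Measure Y) [IsFiniteMeasure γ] (hγ : γ (range E)ᶜ = 0) :
    ∃ Q : Measure X, IsFiniteMeasure Q ∧ Q.map E = γ := by
  have hint : ∀ f : Y →ᵇ ℝ, Integrable f γ := fun f => f.integrable γ
  let T : (Y →ᵇ ℝ) →ₗ[ℝ] C(X, ℝ) :=
    { toFun := fun f => f.toContinuousMap.comp ⟨E, hE⟩
      map_add' := fun f g => rfl
      map_smul' := fun c f => rfl }
  let I : (Y →ᵇ ℝ) →ₗ[ℝ] ℝ :=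
    { toFun := fun f => ∫ y, f y ∂γ
      map_add' := fun f g => integral_add (hint f) (hint g)
      map_smul' := fun c f => integral_smul c f }
  have hae : ∀ᵐ y ∂γ, y ∈ range E := hγ
  have hpos : ∀ f, 0 ≤ T f → 0 ≤ I f := fun f hf => integral_nonneg_of_ae <| by
    filter_upwards [hae]
    rintro _ ⟨x, rfl⟩
    exact hf x
  -- A function that vanishes on the range of `E` has integral zero, so the integral descends to a
  -- functional of `f ∘ E`.
  have hker : T.ker ≤ I.ker := fun f hf => by
    rw [LinearMap.mem_ker] at hf ⊢
    refine le_antisymm ?_ (hpos f hf.ge)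
    have := hpos (-f) (by rw [map_neg, hf, neg_zero])
    rwa [map_neg, Left.nonneg_neg_iff] at this
  let F : C(X, ℝ) →ₗ.[ℝ] ℝ := ⟨T.range, (T.ker.liftQ I hker).comp T.quotKerEquivRange.symm.toLinearMap⟩
  have hF : ∀ f, F ⟨T f, f, rfl⟩ = I f := fun f => by
    have h : T.quotKerEquivRange.symm ⟨T f, f, rfl⟩ = T.ker.mkQ f :=
      T.quotKerEquivRange_symm_apply_image f _
    change T.ker.liftQ I hker (T.quotKerEquivRange.symm ⟨T f, f, rfl⟩) = I f
    rw [h, Submodule.mkQ_apply, Submodule.liftQ_apply]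
  -- Constants belong to the domain and dominate every function on the compact space, so a positive
  -- extension exists.
  obtain ⟨g, hgF, hg⟩ := riesz_extension (PointedCone.positive ℝ C(X, ℝ)) F (by
      rintro ⟨_, f, rfl⟩ h
      rw [hF]
      exact hpos f h) (fun y => by
      refine ⟨⟨T (BoundedContinuousFunction.const Y ‖y‖), _, rfl⟩, fun x => ?_⟩
      have := neg_le_of_abs_le (y.norm_coe_le_norm x)
      change 0 ≤ ‖y‖ + y x
      linarith)
  let Λ : CompactlySupportedContinuousMap X ℝ →ₚ[ℝ] ℝ := PositiveLinearMap.mk₀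
    { toFun := fun f => g f.toContinuousMap
      map_add' := fun f f' => map_add g f.toContinuousMap f'.toContinuousMap
      map_smul' := fun c f => map_smul g c f.toContinuousMap } fun f hf => hg _ hf
  refine ⟨RealRMK.rieszMeasure Λ, inferInstance, ?_⟩
  refine ext_of_forall_integral_eq_of_IsFiniteMeasure fun f => ?_
  rw [integral_map hE.measurable.aemeasurable f.continuous.aestronglyMeasurable]
  have h1 := RealRMK.integral_rieszMeasure Λ ⟨T f, HasCompactSupport.of_compactSpace _⟩
  refine h1.trans ?_
  change g (T f) = I f
  rw [← hF f]
  exact hgF ⟨T f, f, rfl⟩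

/-! ### Compactness of the set of geodesics -/

namespace Heisenberg

variable {n : ℕ}

/-- The geodesics of constant speed with end points in `K`. -/
def geodesics (K : Set (Heis n)) : Set (PathSpace n) :=
  {σ | σ 0 ∈ K ∧ σ 1 ∈ K ∧ IsConstSpeed σ}

theorem isClosed_setOf_isConstSpeed [NeZero n] :
    IsClosed {f : unitInterval → Heis n | IsConstSpeed f} := by
  have hd : ∀ s t : unitInterval, Continuous fun f : unitInterval → Heis n =>
      (f s, f t) := fun s t => by fun_prop
  simp only [IsConstSpeed, ofPred_forall]
  refine isClosed_iInter fun s => isClosed_iInter fun t => isClosed_iInter fun _ =>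
    isClosed_le ?_ (ENNReal.continuous_ofReal.comp (continuous_const.mul ?_))
  · have := (continuous_dSR (n := n)).comp (hd s t)
    exact this
  · have := (continuous_toReal_dSR (n := n)).comp (hd 0 1)
    exact this

/-- Bounded end points give one Lipschitz constant for all these curves, and constant speed is
closed under pointwise convergence; Arzelà–Ascoli applies. -/
theorem isCompact_geodesics [NeZero n] {K : Set (Heis n)} (hK : IsCompact K) :
    IsCompact (geodesics K) := by
  obtain ⟨a, ha⟩ := hK.isBounded.exists_norm_le
  obtain ⟨L, hL⟩ := (hK.prod hK).exists_bound_of_continuousOn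
    (continuous_toReal_dSR (n := n)).continuousOn
  have hlip : ∀ f : unitInterval → Heis n, f 0 ∈ K → f 1 ∈ K → IsConstSpeed f →
      0 ≤ L ∧ ∀ s t : unitInterval, s ≤ t → dSR (f s) (f t) ≤ ENNReal.ofReal ((t - s) * L) := by
    intro f h0 h1 hf
    have h := hL (f 0, f 1) ⟨h0, h1⟩
    rw [Real.norm_of_nonneg ENNReal.toReal_nonneg] at h
    refine ⟨ENNReal.toReal_nonneg.trans h, fun s t hst => (hf s t hst).trans ?_⟩
    have : (0 : ℝ) ≤ t - s := sub_nonneg.2 hst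
    gcongr
  refine ArzelaAscoli.isCompact_of_equicontinuous _ ?_ ?_
  · have himg : ContinuousMap.toFun '' geodesics K =
        {f | f 0 ∈ K} ∩ ({f | f 1 ∈ K} ∩ {f | IsConstSpeed f}) := by
      ext f
      constructor
      · rintro ⟨σ, hσ, rfl⟩
        exact hσ
      · intro hf
        exact ⟨⟨f, hf.2.2.lipschitzWith.continuous⟩, hf, rfl⟩
    rw [himg]
    refine IsCompact.of_isClosed_subset (isCompact_univ_pi fun _ : unitInterval =>
      isCompact_closedBall (0 : Heis n) (a + (1 + a + L) * L)) ?_ fun f hf t _ => ?_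
    · have he : ∀ t, Continuous fun f : unitInterval → Heis n => f t := continuous_apply
      exact (hK.isClosed.preimage (he 0)).inter
        ((hK.isClosed.preimage (he 1)).inter isClosed_setOf_isConstSpeed)
    · rw [mem_closedBall_zero_iff]
      obtain ⟨hL0, h⟩ := hlip f hf.1 hf.2.1 hf.2.2
      exact norm_le_of_dSR_lipschitz hL0 (ha _ hf.1) h t
  · refine (LipschitzWith.uniformEquicontinuous _ (lipConst a L).toNNReal fun σ => ?_).equicontinuous
    obtain ⟨hL0, h⟩ := hlip σ.1 σ.2.1 σ.2.2.1 σ.2.2.2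
    refine LipschitzWith.of_dist_le_mul fun s t => ?_
    rw [Real.coe_toNNReal _ (lipConst_nonneg ((norm_nonneg _).trans (ha _ σ.2.1)) hL0)]
    exact dist_le_of_dSR_lipschitz hL0 (ha _ σ.2.1) h s t

/-! ### Lagrangian cost, transport cost and optimal plans -/

theorem lowerSemicontinuous_length [NeZero n] :
    LowerSemicontinuous (length : PathSpace n → ℝ≥0∞) := by
  unfold length
  refine lowerSemicontinuous_iSup fun k => lowerSemicontinuous_iSup fun t =>
    lowerSemicontinuous_iSup fun _ => Continuous.lowerSemicontinuous ?_
  refine continuous_finsetSum _ fun i _ => ?_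
  have h1 : Continuous fun σ : PathSpace n => (σ (t i.castSucc), σ (t i.succ)) := by fun_prop
  have h2 := (continuous_dSR (n := n)).comp h1
  exact h2

theorem continuous_endpoints : Continuous fun σ : PathSpace n => (σ 0, σ 1) := by fun_prop

theorem isPlan_endpointLaw_iff {μ ν : Measure (Heis n)} {Q : Measure (PathSpace n)}
    [IsProbabilityMeasure Q] : IsPlan μ ν (endpointLaw Q) ↔ IsAdmissible μ ν Q := by
  have hE := (continuous_endpoints (n := n)).measurable
  have h1 : (endpointLaw Q).map Prod.fst = Q.map fun σ => σ 0 :=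
    Measure.map_map measurable_fst hE
  have h2 : (endpointLaw Q).map Prod.snd = Q.map fun σ => σ 1 :=
    Measure.map_map measurable_snd hE
  constructor
  · rintro ⟨-, h, h'⟩
    exact ⟨inferInstance, h1 ▸ h, h2 ▸ h'⟩
  · rintro ⟨-, h, h'⟩
    exact ⟨Measure.isProbabilityMeasure_map hE.aemeasurable, h1.trans h, h2.trans h'⟩

theorem planCost_endpointLaw [NeZero n] (Q : Measure (PathSpace n)) :
    planCost (endpointLaw Q) = ∫⁻ σ, dSR (σ 0) (σ 1) ∂Q :=
  lintegral_map continuous_dSR.measurable continuous_endpoints.measurable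

theorem planCost_endpointLaw_le [NeZero n] (Q : Measure (PathSpace n)) :
    planCost (endpointLaw Q) ≤ lagrangianCost Q := by
  rw [planCost_endpointLaw]
  exact lintegral_mono dSR_le_length

theorem lagrangianCost_eq_planCost [NeZero n] {Q : Measure (PathSpace n)}
    (hQ : ∀ᵐ σ ∂Q, IsReparamOfMinimizingHorizontal σ) :
    lagrangianCost Q = planCost (endpointLaw Q) := by
  rw [planCost_endpointLaw]
  exact lintegral_congr_ae (hQ.mono fun σ hσ => length_eq_dSR_iff.2 hσ)

/-- The length dominates the distance of the end points; when the integrals compare the other way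
and are finite, the two functions agree almost everywhere. Semicontinuity supplies the measurability
of the length. -/
theorem ae_isReparam_of_lagrangianCost_le [NeZero n] {Q : Measure (PathSpace n)}
    (hfin : planCost (endpointLaw Q) ≠ ∞) (h : lagrangianCost Q ≤ planCost (endpointLaw Q)) :
    ∀ᵐ σ ∂Q, IsReparamOfMinimizingHorizontal σ := by
  rw [planCost_endpointLaw] at hfin h
  have := ae_eq_of_ae_le_of_lintegral_le (Filter.Eventually.of_forall dSR_le_length) hfin
    lowerSemicontinuous_length.measurable.aemeasurable h
  exact this.mono fun σ hσ => length_eq_dSR_iff.1 hσ.symm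

/-- Every plan is induced by a probability measure on geodesics. -/
theorem IsPlan.exists_lift [NeZero n] {μ ν : Measure (Heis n)} {γ : Measure (Heis n × Heis n)}
    (hγ : IsPlan μ ν γ) {K : Set (Heis n)} (hK : IsCompact K) (hμK : μ.support ⊆ K)
    (hνK : ν.support ⊆ K) :
    ∃ P : ProbabilityMeasure (geodesics K),
      (P : Measure (geodesics K)).map (fun σ => (σ.1 0, σ.1 1)) = γ := by
  have := hγ.prob
  have : CompactSpace (geodesics K) := isCompact_iff_compactSpace.1 (isCompact_geodesics hK)
  have hE : Continuous fun σ : geodesics K => (σ.1 0, σ.1 1) :=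
    continuous_endpoints.comp continuous_subtype_val
  obtain ⟨Q, hQ, hQγ⟩ := Measure.exists_map_eq_of_compactSpace hE γ (by
    -- The plan is carried by the product of the supports, and each pair there is joined by a
    -- geodesic in `geodesics K`.
    have h1 : γ (Prod.fst ⁻¹' μ.supportᶜ) = 0 := by
      rw [← Measure.map_apply measurable_fst Measure.isOpen_compl_support.measurableSet,
        hγ.map_fst, Measure.measure_compl_support]
    have h2 : γ (Prod.snd ⁻¹' ν.supportᶜ) = 0 := by
      rw [← Measure.map_apply measurable_snd Measure.isOpen_compl_support.measurableSet,
        hγ.map_snd, Measure.measure_compl_support]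
    refine measure_mono_null (fun p hp => ?_) (measure_union_null h1 h2)
    by_contra hcon
    simp only [mem_union, mem_preimage, mem_compl_iff, not_or, not_not] at hcon
    obtain ⟨σ, h0, h1, hσ⟩ := exists_isConstSpeed p.1 p.2
    exact hp ⟨⟨σ, h0 ▸ hμK hcon.1, h1 ▸ hνK hcon.2, hσ⟩, Prod.ext h0 h1⟩)
  have hprob : IsProbabilityMeasure Q := by
    constructor
    have : Q.map (fun σ : geodesics K => (σ.1 0, σ.1 1)) univ = 1 := by
      rw [hQγ]; exact measure_univ
    rwa [Measure.map_apply hE.measurable MeasurableSet.univ, preimage_univ] at this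
  exact ⟨⟨Q, hprob⟩, hQγ⟩

theorem endpointLaw_map_val {K : Set (Heis n)} (P : Measure (geodesics K)) :
    endpointLaw (P.map Subtype.val) = P.map fun σ => (σ.1 0, σ.1 1) :=
  Measure.map_map continuous_endpoints.measurable measurable_subtype_coe

theorem ae_map_val_isConstSpeed [NeZero n] {K : Set (Heis n)} (hK : IsCompact K)
    (P : Measure (geodesics K)) : ∀ᵐ σ : PathSpace n ∂P.map Subtype.val, IsConstSpeed σ := by
  have hmeas : MeasurableSet (geodesics K) := (isCompact_geodesics hK).isClosed.measurableSet
  have : ∀ᵐ σ : PathSpace n ∂P.map Subtype.val, σ ∈ geodesics K :=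
    (ae_map_iff measurable_subtype_coe.aemeasurable hmeas).2
      (Filter.Eventually.of_forall fun σ => σ.2)
  exact this.mono fun σ hσ => hσ.2.2

/-- Among the plans of measures with compact support there is an optimal one; it has finite cost
and is induced by a probability measure on geodesics. -/
theorem exists_optimal_lift [NeZero n] {μ ν : Measure (Heis n)}
    (hμ : IsCompactlySupportedProb μ) (hν : IsCompactlySupportedProb ν) :
    ∃ Q : Measure (PathSpace n), IsProbabilityMeasure Q ∧ (∀ᵐ σ ∂Q, IsMinimizingHorizontal σ) ∧
      IsOptimalPlan μ ν (endpointLaw Q) ∧ planCost (endpointLaw Q) < ∞ := by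
  have := hμ.prob
  have := hν.prob
  set K := μ.support ∪ ν.support
  have hK : IsCompact K := hμ.compact_support.union hν.compact_support
  have : CompactSpace (geodesics K) := isCompact_iff_compactSpace.1 (isCompact_geodesics hK)
  have hE : Continuous fun σ : geodesics K => (σ.1 0, σ.1 1) :=
    continuous_endpoints.comp continuous_subtype_val
  have he0 : Continuous fun σ : geodesics K => σ.1 0 := continuous_fst.comp hE
  have he1 : Continuous fun σ : geodesics K => σ.1 1 := continuous_snd.comp hE
  have hlift : ∀ γ, IsPlan μ ν γ → ∃ P : ProbabilityMeasure (geodesics K),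
      (P : Measure (geodesics K)).map (fun σ => (σ.1 0, σ.1 1)) = γ := fun γ hγ =>
    hγ.exists_lift hK subset_union_left subset_union_right
  let c : BoundedContinuousFunction (geodesics K) ℝ := BoundedContinuousFunction.mkOfCompact
    ⟨fun σ => (dSR (σ.1 0) (σ.1 1)).toReal, by
      have := (continuous_toReal_dSR (n := n)).comp hE
      exact this⟩
  have hcost : ∀ P : ProbabilityMeasure (geodesics K),
      planCost ((P : Measure (geodesics K)).map fun σ => (σ.1 0, σ.1 1)) =
        ENNReal.ofReal (∫ σ, c σ ∂(P : Measure (geodesics K))) := fun P => by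
    rw [planCost, lintegral_map continuous_dSR.measurable hE.measurable,
      ofReal_integral_eq_lintegral_ofReal (c.integrable _)
        (Filter.Eventually.of_forall fun σ => ENNReal.toReal_nonneg)]
    exact lintegral_congr fun σ => (ENNReal.ofReal_toReal (dSR_ne_top _ _)).symm
  -- The marginal constraints are closed for weak convergence, and the probability measures on a
  -- compact space form a compact space.
  let A : Set (ProbabilityMeasure (geodesics K)) :=
    {P | P.map he0.measurable.aemeasurable = ⟨μ, hμ.prob⟩} ∩
      {P | P.map he1.measurable.aemeasurable = ⟨ν, hν.prob⟩}
  have hA : ∀ P : ProbabilityMeasure (geodesics K), P ∈ A ↔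
      IsPlan μ ν ((P : Measure (geodesics K)).map fun σ => (σ.1 0, σ.1 1)) := fun P => by
    have h1 : ((P : Measure (geodesics K)).map fun σ => (σ.1 0, σ.1 1)).map Prod.fst =
        (P : Measure (geodesics K)).map fun σ => σ.1 0 :=
      Measure.map_map measurable_fst hE.measurable
    have h2 : ((P : Measure (geodesics K)).map fun σ => (σ.1 0, σ.1 1)).map Prod.snd =
        (P : Measure (geodesics K)).map fun σ => σ.1 1 :=
      Measure.map_map measurable_snd hE.measurable
    constructor
    · intro h
      exact ⟨Measure.isProbabilityMeasure_map hE.measurable.aemeasurable,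
        h1.trans (Subtype.ext_iff.1 h.1), h2.trans (Subtype.ext_iff.1 h.2)⟩
    · intro h
      exact ⟨Subtype.ext (h1.symm.trans h.map_fst), Subtype.ext (h2.symm.trans h.map_snd)⟩
  have hAclosed : IsClosed A :=
    (isClosed_eq (ProbabilityMeasure.continuous_map he0) continuous_const).inter
      (isClosed_eq (ProbabilityMeasure.continuous_map he1) continuous_const)
  have hAne : A.Nonempty := by
    have hprod : IsPlan μ ν (μ.prod ν) := ⟨inferInstance, by simp, by simp⟩
    obtain ⟨P, hP⟩ := hlift _ hprod
    exact ⟨P, (hA P).2 (hP ▸ hprod)⟩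
  have hccont : Continuous fun P : ProbabilityMeasure (geodesics K) =>
      ∫ σ, c σ ∂(P : Measure (geodesics K)) :=
    continuous_iff_continuousAt.2 fun P =>
      ProbabilityMeasure.tendsto_iff_forall_integral_tendsto.1 Filter.tendsto_id c
  obtain ⟨P, hPA, hP⟩ := hAclosed.isCompact.exists_isMinOn hAne hccont.continuousOn
  refine ⟨(P : Measure (geodesics K)).map Subtype.val,
    Measure.isProbabilityMeasure_map measurable_subtype_coe.aemeasurable,
    (ae_map_val_isConstSpeed hK _).mono fun σ hσ => hσ.isMinimizingHorizontal, ?_, ?_⟩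
  · rw [endpointLaw_map_val]
    refine ⟨(hA P).1 hPA, fun γ hγ => ?_⟩
    obtain ⟨P', rfl⟩ := hlift γ hγ
    rw [hcost, hcost]
    exact ENNReal.ofReal_le_ofReal (hP ((hA P').2 hγ))
  · rw [endpointLaw_map_val, hcost]
    exact ENNReal.ofReal_lt_top

end Heisenberg

end

/-! ### The equivalence of the two problems -/

open Heisenberg

theorem theorem4p8 (n : ℕ) (hn : 1 ≤ n) (μ ν : Measure (Heisenberg.Heis n))
    (hμ : Heisenberg.IsCompactlySupportedProb μ) (hν : Heisenberg.IsCompactlySupportedProb ν) :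
    -- the Lagrangian problem has a solution, even one that lives on minimizing horizontal curves
    (∃ Q : Measure (Heisenberg.PathSpace n), Heisenberg.IsLagrangianOptimal μ ν Q ∧
      ∀ᵐ σ ∂Q, Heisenberg.IsMinimizingHorizontal σ) ∧
    -- its value is the minimum of the Monge-Kantorovich problem, and is finite
    (∃ γ, Heisenberg.IsOptimalPlan μ ν γ) ∧
    Heisenberg.lagrangianValue μ ν = Heisenberg.mongeKantorovich μ ν ∧
    Heisenberg.mongeKantorovich μ ν < ∞ ∧
    -- characterization of all solutions
    (∀ Q : Measure (Heisenberg.PathSpace n), IsProbabilityMeasure Q →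
      (Heisenberg.IsLagrangianOptimal μ ν Q ↔
        (∀ᵐ σ ∂Q, Heisenberg.IsReparamOfMinimizingHorizontal σ) ∧
          Heisenberg.IsOptimalPlan μ ν (Heisenberg.endpointLaw Q))) ∧
    -- on absolutely continuous curves no reparametrization is needed
    (∀ Q : Measure (Heisenberg.PathSpace n), IsProbabilityMeasure Q →
      (∀ᵐ σ ∂Q, Heisenberg.IsAC σ) →
      (Heisenberg.IsLagrangianOptimal μ ν Q ↔
        (∀ᵐ σ ∂Q, Heisenberg.IsMinimizingHorizontal σ) ∧
          Heisenberg.IsOptimalPlan μ ν (Heisenberg.endpointLaw Q))) := by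
  have : NeZero n := ⟨by omega⟩
  obtain ⟨Q₀, hQ₀, hmin, hopt, hfin⟩ := exists_optimal_lift hμ hν
  have hcost₀ : lagrangianCost Q₀ = planCost (endpointLaw Q₀) :=
    lagrangianCost_eq_planCost (hmin.mono fun σ hσ => hσ.isReparam)
  have hle : ∀ Q, IsAdmissible μ ν Q → lagrangianCost Q₀ ≤ lagrangianCost Q := fun Q hQ => by
    have := hQ.prob
    rw [hcost₀]
    exact (hopt.2 _ (isPlan_endpointLaw_iff.2 hQ)).trans (planCost_endpointLaw_le Q)
  have hadm : IsAdmissible μ ν Q₀ := isPlan_endpointLaw_iff.1 hopt.1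
  have hMK : mongeKantorovich μ ν = planCost (endpointLaw Q₀) :=
    le_antisymm (iInf₂_le _ hopt.1) (le_iInf₂ hopt.2)
  have hchar : ∀ Q : Measure (PathSpace n), IsProbabilityMeasure Q →
      (IsLagrangianOptimal μ ν Q ↔ (∀ᵐ σ ∂Q, IsReparamOfMinimizingHorizontal σ) ∧
        IsOptimalPlan μ ν (endpointLaw Q)) := by
    intro Q hQ
    constructor
    · rintro ⟨hQadm, hQopt⟩
      have hplan : IsPlan μ ν (endpointLaw Q) := isPlan_endpointLaw_iff.2 hQadm
      -- Optimality closes the chain of inequalities: the Lagrangian cost of `Q` is at most the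
      -- minimal transport cost, hence at most the transport cost of its own endpoint law.
      have hQ₀le : lagrangianCost Q ≤ planCost (endpointLaw Q₀) := hcost₀ ▸ hQopt Q₀ hadm
      have hcle : planCost (endpointLaw Q) ≤ planCost (endpointLaw Q₀) :=
        (planCost_endpointLaw_le Q).trans hQ₀le
      exact ⟨ae_isReparam_of_lagrangianCost_le (hcle.trans_lt hfin).ne
        (hQ₀le.trans (hopt.2 _ hplan)), hplan, fun γ hγ => hcle.trans (hopt.2 γ hγ)⟩
    · rintro ⟨hrep, hplan, hQopt⟩
      refine ⟨isPlan_endpointLaw_iff.1 hplan, fun Q' hQ' => ?_⟩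
      have := hQ'.prob
      rw [lagrangianCost_eq_planCost hrep]
      exact (hQopt _ (isPlan_endpointLaw_iff.2 hQ')).trans (planCost_endpointLaw_le Q')
  refine ⟨⟨Q₀, ⟨hadm, hle⟩, hmin⟩, ⟨_, hopt⟩, ?_, hMK ▸ hfin, hchar, fun Q hQ hAC => ?_⟩
  · rw [hMK, ← hcost₀]
    exact le_antisymm (iInf₂_le _ hadm) (le_iInf₂ hle)
  · rw [hchar Q hQ]
    refine and_congr_left fun _ => ⟨fun h => ?_, fun h => h.mono fun σ hσ => hσ.isReparam⟩
    filter_upwards [h, hAC] with σ h1 h2 using h1.isMinimizingHorizontal h2
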